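/- **Setting.** Let $\mathbf V$ be a nonempty (possibly infinite) set of endogenous variables, each $V\in\mathbf V$ having a finite range $\mathrm{Val}(V)$ with at least two elements. A structural causal model (SCM) $\mathfrak M=(\mathcal F,P)$ consists of a set of exogenous variables with ranges, a probability measure $P$ on some $\sigma$-algebra of instantiations $\mathbf u$ of them, and a function $f_V(\mathbf v,\mathbf u)\in\mathrm{Val}(V)$ for every $V$, where $\mathbf v$ ranges over instantiations of $\mathbf V$. It is *recursive* if for some well-order $\prec$ of $\mathbf V$ each $f_V(\mathbf v,\mathbf u)$ depends on $\mathbf v$ only through the values of variables $V'\prec V$; then for each $\mathbf u$ the equations $\mathbf v(V)=f_V(\mathbf v,\mathbf u)$ have a unique solution. It is *measurable* if, after replacing finitely many $f_V$ by arbitrary constants, the solution is always a measurable function of $\mathbf u$ (for the product $\sigma$-algebra on instantiations of $\mathbf V$). Its graph $\mathcal G_{\mathfrak M}$ has an edge $X\to Y$ iff there are instantiations $\mathbf v_1,\mathbf v_2$ of $\mathbf V$ differing exactly at $X$ and a non-negligible set $A$ of exogenous instantiations such that $f_Y(\mathbf v_1,\cdot)$ and $f_Y(\mathbf v_2,\cdot)$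 are constant on $A$ with different values. A *Markov structure* is a recursive, measurable SCM such that, under the distribution of the solution, each variable is independent of its non-descendants in $\mathcal G_{\mathfrak M}$ conditionally on (the $\sigma$-algebra generated by) its parents in $\mathcal G_{\mathfrak M}$. Formulas of $\mathcal L_1$ are Boolean combinations of inequalities between polynomial terms (built with $+,\cdot,-$) in the probabilities $\mathbb P(\beta)$ of propositional formulas $\beta$ over atoms $V=v$; in $\mathfrak M$, $\mathbb P(\beta)$ denotes the $P$-probability that the solution satisfies $\beta$. For a directed graph $\mathcal G$ on $\mathbf V$, write $\mathcal G\models\varphi$ if $\varphi$ holds in every Markov structure $\mathfrak M$ with $\mathcal G_{\mathfrak M}=\mathcal G$. For finite sets $\mathbf X,\mathbf Y,\mathbf Z\subseteq\mathbf V$, the schema $\mathbb P(\mathbf X\wedge\mathbf Y\mid\mathbf Z)\equiv\mathbb P(\mathbf X\mid\mathbf Z)\,\mathbb P(\mathbf Y\mid\mathbf Z)$ denotes the $\mathcal L_1$ formula that is the conjunction, over all instantiations $\mathbf x,\mathbf y,\mathbf z$ of $\mathbf X,\mathbf Y,\mathbf Z$, of $$\mathbb P(\mathbf x\wedge\mathbf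 y\wedge\mathbf z)\cdot\mathbb P(\mathbf z)\equiv\mathbb P(\mathbf x\wedge\mathbf z)\cdot\mathbb P(\mathbf y\wedge\mathbf z).$$ $\mathbf X$ and $\mathbf Y$ are *d-separated* by $\mathbf Z$ in $\mathcal G$, written $((\mathbf X\perp\!\!\!\perp\mathbf Y)\mid\mathbf Z)_{\mathcal G}$, if there is no active path from a member of $\mathbf X$ to a member of $\mathbf Y$, where a path (distinct vertices, consecutive ones joined by an edge in either direction; a single vertex is a path) is active if each collider on it is in $\mathbf Z$ or has a descendant in $\mathbf Z$, and no other vertex on it, end points included, is in $\mathbf Z$. **Proposition.** Let $\mathcal G$ range over the well-founded directed graphs on $\mathbf V$ (when $\mathbf V$ is finite, these are exactly the dags), and let $\mathbf X,\mathbf Y,\mathbf Z\subseteq\mathbf V$ be finite. Then $$\mathcal G\models\ \mathbb P(\mathbf X\wedge\mathbf Y\mid\mathbf Z)\equiv\mathbb P(\mathbf X\mid\mathbf Z)\,\mathbb P(\mathbf Y\mid\mathbf Z)\quad\text{if and only if}\quad((\mathbf X\perp\!\!\!\perp\mathbf Y)\mid\mathbf Z)_{\mathcal G}.$$ In other words,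 d-separation is definable in $\mathcal L_1$: for all finite $\mathbf X,\mathbf Y,\mathbf Z$ there is an $\mathcal L_1$ formula $\varphi$ such that for every such $\mathcal G$, $\mathcal G\models\varphi$ iff $((\mathbf X\perp\!\!\!\perp\mathbf Y)\mid\mathbf Z)_{\mathcal G}$. -/

import Mathlib

open MeasureTheory ProbabilityTheory

universe u v w w'

namespace CausalLogic

/-- Instantiations of all endogenous variables. -/
def Inst {V : Type u} (Val : V → Type v) : Type (max u v) := ∀ X : V, Val X

/-- The product σ-algebra on endogenous instantiations, each `Val X` being discrete. -/
instance {V : Type u} (Val : V → Type v) : MeasurableSpace (Inst Val) :=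
  MeasurableSpace.pi (m := fun _ => ⊤)

instance {V : Type u} (Val : V → Type v) [∀ X, Nontrivial (Val X)] : Nonempty (Inst Val) :=
  ⟨fun _ => Classical.arbitrary _⟩

/-! ### Structural causal models -/

/-- A structural causal model over the endogenous signature `Val`. The exogenous variables, their
ranges and the probability space of exogenous instantiations belong to the model. -/
structure SCM {V : Type u} (Val : V → Type v) where
  /-- the exogenous variables -/
  Exo : Type w
  /-- the ranges of the exogenous variables -/
  ExoVal : Exo → Type w'
  /-- the σ-algebra of exogenous instantiations -/
  sigma : MeasurableSpace (∀ R, ExoVal R)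
  /-- the probability measure on exogenous instantiations -/
  P : @Measure (∀ R, ExoVal R) sigma
  isProb : @IsProbabilityMeasure (∀ R, ExoVal R) sigma P
  /-- the structural functions -/
  f : ∀ X : V, Inst Val → (∀ R, ExoVal R) → Val X

namespace SCM

variable {V : Type u} {Val : V → Type v}

/-- Instantiations of all exogenous variables of `M`. -/
def ExoInst (M : SCM.{u, v, w, w'} Val) : Type (max w w') := ∀ R, M.ExoVal R

instance (M : SCM.{u, v, w, w'} Val) : MeasurableSpace M.ExoInst := M.sigma

/-- The probability measure of the model. -/
def prob (M : SCM.{u, v, w, w'} Val) : Measure M.ExoInst := M.P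

instance (M : SCM.{u, v, w, w'} Val) : IsProbabilityMeasure M.prob := M.isProb

/-- `M` is recursive: for some well-order on the endogenous variables, each structural function
depends on its endogenous arguments only through strictly smaller variables. -/
def IsRecursive (M : SCM.{u, v, w, w'} Val) : Prop :=
  ∃ r : V → V → Prop, IsWellOrder V r ∧
    ∀ (X : V) (e : M.ExoInst) (s₁ s₂ : Inst Val),
      (∀ Y, r Y X → s₁ Y = s₂ Y) → M.f X s₁ e = M.f X s₂ e

/-- `s` solves the simultaneous equations of `M` at the exogenous instantiation `e`. -/
def IsSolution (M : SCM.{u, v, w, w'} Val) (e : M.ExoInst) (s : Inst Val) : Prop :=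
  ∀ X, s X = M.f X s e

theorem IsRecursive.existsUnique_isSolution [∀ X, Nontrivial (Val X)]
    {M : SCM.{u, v, w, w'} Val} (hM : M.IsRecursive) (e : M.ExoInst) :
    ∃! s, M.IsSolution e s := by
  classical
  obtain ⟨r, hr, hf⟩ := hM
  have wf : WellFounded r := hr.wf
  let d : Inst Val := Classical.arbitrary _
  let s : Inst Val := wf.fix fun X ih => M.f X (fun Y => if h : r Y X then ih Y h else d Y) e
  refine ⟨s, fun X => ?_, fun t ht => ?_⟩
  · have h1 : s X = M.f X (fun Y => if r Y X then s Y else d Y) e := by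
      have h2 := wf.fix_eq
        (fun X ih => M.f X (fun Y => if h : r Y X then ih Y h else d Y) e) X
      simpa [s] using h2
    rw [h1]
    apply hf
    intro Y hY
    simp [hY]
  · funext X
    induction X using wf.induction with
    | _ X ih =>
      have h1 : s X = M.f X (fun Y => if r Y X then s Y else d Y) e := by
        have h2 := wf.fix_eq
          (fun X ih => M.f X (fun Y => if h : r Y X then ih Y h else d Y) e) X
        simpa [s] using h2
      rw [h1, ht X]
      apply hf
      intro Y hY
      simpa [hY] using ih Y hY

/-- The solution of the simultaneous equations at `e` (the unique one if `M` is recursive). -/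
noncomputable def solution [∀ X, Nontrivial (Val X)] (M : SCM.{u, v, w, w'} Val)
    (e : M.ExoInst) : Inst Val :=
  Classical.epsilon (M.IsSolution e)

theorem IsRecursive.solution_spec [∀ X, Nontrivial (Val X)]
    {M : SCM.{u, v, w, w'} Val} (hM : M.IsRecursive) (e : M.ExoInst) :
    M.IsSolution e (M.solution e) :=
  Classical.epsilon_spec (hM.existsUnique_isSolution e).exists

/-- The model obtained by holding each `X` with `i X = some x` fixed at `x`. -/
def intervene (M : SCM.{u, v, w, w'} Val) (i : ∀ X, Option (Val X)) : SCM.{u, v, w, w'} Val where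
  Exo := M.Exo
  ExoVal := M.ExoVal
  sigma := M.sigma
  P := M.P
  isProb := M.isProb
  f := fun X s e => (i X).getD (M.f X s e)

/-- The joint distribution of the endogenous variables. -/
noncomputable def jointDist [∀ X, Nontrivial (Val X)] (M : SCM.{u, v, w, w'} Val) :
    Measure (Inst Val) :=
  M.prob.map M.solution

/-- `M` is measurable: under every finite intervention the joint distribution of the endogenous
variables is well defined, that is, the solution is a random element of the product space. -/
def IsMeasurable [∀ X, Nontrivial (Val X)] (M : SCM.{u, v, w, w'} Val) : Prop :=
  ∀ i : ∀ X, Option (Val X), {X | (i X).isSome}.Finite → Measurable (M.intervene i).solution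

/-- Direct causal influence of `X` on `Y`. (The value of `M.prob` on a set that is
not measurable is its outer measure, so `M.prob A ≠ 0` says that `A` is not negligible.) -/
def Influences (M : SCM.{u, v, w, w'} Val) (X Y : V) : Prop :=
  ∃ (s₁ s₂ : Inst Val) (A : Set M.ExoInst),
    s₁ X ≠ s₂ X ∧ (∀ W, W ≠ X → s₁ W = s₂ W) ∧ M.prob A ≠ 0 ∧
    ∀ e ∈ A, ∀ e' ∈ A, M.f Y s₁ e = M.f Y s₁ e' ∧ M.f Y s₁ e' ≠ M.f Y s₂ e ∧
      M.f Y s₂ e = M.f Y s₂ e'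

end SCM

/-! ### Conditional independence and the Markov condition -/

section Markov

variable {V : Type u} {Val : V → Type v}

/-- The σ-algebra on endogenous instantiations generated by the variables in `S`. -/
abbrev sigmaOf (Val : V → Type v) (S : Set V) : MeasurableSpace (Inst Val) :=
  ⨆ X ∈ S, MeasurableSpace.comap (fun s : Inst Val => s X) ⊤

/-- The variables in `A` are independent of those in `B` conditionally on those in `C`, under `μ`. -/
def CondIndepVars (μ : Measure (Inst Val)) (A B C : Set V) : Prop :=
  ∀ a b : Set (Inst Val), MeasurableSet[sigmaOf Val A] a → MeasurableSet[sigmaOf Val B] b →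
    μ⟦a ∩ b | sigmaOf Val C⟧ =ᵐ[μ] μ⟦a | sigmaOf Val C⟧ * μ⟦b | sigmaOf Val C⟧

/-- Under the joint distribution of `M`, each variable is independent of its non-descendants
conditionally on its parents, in the graph of direct causal influence of `M`. -/
def SCM.IsMarkov [∀ X, Nontrivial (Val X)] (M : SCM.{u, v, w, w'} Val) : Prop :=
  ∀ X : V, CondIndepVars M.jointDist {X}
    {Y | ¬ Relation.ReflTransGen M.Influences X Y} {Y | M.Influences Y X}

end Markov

/-! ### d-separation -/

/-- `p 0, …, p n` is a path (distinct vertices, consecutive ones joined by an edge of `G` in either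
direction) that is active given `Z`: every collider on it has a descendant in `Z`, possibly itself,
and no other vertex on it, end points included, is in `Z`. -/
structure IsActivePath {V : Type u} (G : V → V → Prop) (Z : Set V) (n : ℕ) (p : ℕ → V) :
    Prop where
  injOn : Set.InjOn p (Set.Iic n)
  adj : ∀ i < n, G (p i) (p (i + 1)) ∨ G (p (i + 1)) (p i)
  start_notMem : p 0 ∉ Z
  end_notMem : p n ∉ Z
  collider : ∀ i, i + 2 ≤ n → G (p i) (p (i + 1)) ∧ G (p (i + 2)) (p (i + 1)) →
    ∃ z ∈ Z, Relation.ReflTransGen G (p (i + 1)) z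
  noncollider : ∀ i, i + 2 ≤ n → ¬ (G (p i) (p (i + 1)) ∧ G (p (i + 2)) (p (i + 1))) →
    p (i + 1) ∉ Z

/-- `X` and `Y` are d-separated by `Z` in `G`. -/
def DSeparated {V : Type u} (G : V → V → Prop) (X Y Z : Set V) : Prop :=
  ∀ (n : ℕ) (p : ℕ → V), p 0 ∈ X → p n ∈ Y → ¬ IsActivePath G Z n p

/-! ### The probability language -/

/-- Propositional formulas over the atoms `X = x`. -/
inductive PropFormula {V : Type u} (Val : V → Type v) : Type (max u v)
  | atom (X : V) (x : Val X) : PropFormula Val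
  | neg : PropFormula Val → PropFormula Val
  | and : PropFormula Val → PropFormula Val → PropFormula Val

/-- Polynomial terms over the probabilities of propositional formulas. -/
inductive ProbTerm {V : Type u} (Val : V → Type v) : Type (max u v)
  | prob : PropFormula Val → ProbTerm Val
  | add : ProbTerm Val → ProbTerm Val → ProbTerm Val
  | mul : ProbTerm Val → ProbTerm Val → ProbTerm Val
  | neg : ProbTerm Val → ProbTerm Val

/-- The language `ℒ₁`: Boolean combinations of inequalities between terms. -/
inductive L1 {V : Type u} (Val : V → Type v) : Type (max u v)
  | ge : ProbTerm Val → ProbTerm Val → L1 Val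
  | neg : L1 Val → L1 Val
  | and : L1 Val → L1 Val → L1 Val

section Semantics

variable {V : Type u} {Val : V → Type v}

/-- Truth of a propositional formula at an endogenous instantiation. -/
def PropFormula.Holds (s : Inst Val) : PropFormula Val → Prop
  | .atom X x => s X = x
  | .neg φ => ¬ φ.Holds s
  | .and φ ψ => φ.Holds s ∧ ψ.Holds s

/-- The value of a term in `M`. -/
noncomputable def ProbTerm.eval [∀ X, Nontrivial (Val X)] (M : SCM.{u, v, w, w'} Val) :
    ProbTerm Val → ℝ
  | .prob φ => M.prob.real {e | φ.Holds (M.solution e)}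
  | .add s t => s.eval M + t.eval M
  | .mul s t => s.eval M * t.eval M
  | .neg t => - t.eval M

/-- Truth of an `ℒ₁` formula in `M`. -/
def L1.Holds [∀ X, Nontrivial (Val X)] (M : SCM.{u, v, w, w'} Val) : L1 Val → Prop
  | .ge s t => s.eval M ≥ t.eval M
  | .neg φ => ¬ φ.Holds M
  | .and φ ψ => φ.Holds M ∧ ψ.Holds M

/-- `G` validates `φ`: the formula holds in all Markov structures (measurable, recursive, Markov
SCMs) whose graph of direct causal influence is `G`. -/
def Validates [∀ X, Nontrivial (Val X)] (G : V → V → Prop) (φ : L1 Val) : Prop :=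
  ∀ M : SCM.{u, v, w, w'} Val, M.IsRecursive → M.IsMeasurable → M.IsMarkov →
    M.Influences = G → φ.Holds M

end Semantics

section Schema

variable {V : Type u} {Val : V → Type v} [Nonempty V] [∀ X, Nontrivial (Val X)]

/-- A propositional tautology. -/
noncomputable def PropFormula.top : PropFormula Val :=
  let a : PropFormula Val := .atom (Classical.arbitrary V) (Classical.arbitrary _)
  .neg (.and a (.neg a))

/-- The conjunction of a list of propositional formulas. -/
noncomputable def PropFormula.conj (l : List (PropFormula Val)) : PropFormula Val :=
  l.foldr .and .top

/-- The conjunction of a list of `ℒ₁` formulas. -/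
noncomputable def L1.conj (l : List (L1 Val)) : L1 Val :=
  l.foldr .and (.ge (.prob .top) (.prob .top))

/-- `s ≡ t`, the conjunction of the two inequalities. -/
def L1.eqv (s t : ProbTerm Val) : L1 Val := .and (.ge s t) (.ge t s)

/-- The formula saying that the variables in `X` have the values given by `x`. -/
noncomputable def PropFormula.inst (X : Finset V) (x : ∀ W : X, Val W) : PropFormula Val :=
  .conj (Finset.univ.toList.map fun W : X => .atom W (x W))

/-- The instance `ℙ(x ∧ y | z) ≡ ℙ(x | z) ℙ(y | z)` for propositional formulas, with
denominators cleared: `ℙ((x ∧ y) ∧ z) · ℙ(z) ≡ ℙ(x ∧ z) · ℙ(y ∧ z)`. -/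
def condIndepInstance (x y z : PropFormula Val) : L1 Val :=
  .eqv (.mul (.prob (.and (.and x y) z)) (.prob z))
    (.mul (.prob (.and x z)) (.prob (.and y z)))

open Classical in
/-- The list of all instantiations of a finite set of variables. -/
noncomputable def allInst [∀ X, Finite (Val X)] (X : Finset V) : List (∀ W : X, Val W) :=
  letI : Fintype (∀ W : X, Val W) := Fintype.ofFinite _
  Finset.univ.toList

/-- The schema `ℙ(X ∧ Y | Z) ≡ ℙ(X | Z) ℙ(Y | Z)`: the conjunction of its instances over all
instantiations of `X`, `Y` and `Z`. -/
noncomputable def condIndepSchema (Val : V → Type v) [∀ X, Nontrivial (Val X)]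
    [∀ X, Finite (Val X)] (X Y Z : Finset V) : L1 Val :=
  .conj ((allInst X).flatMap fun x => (allInst Y).flatMap fun y => (allInst Z).map fun z =>
    condIndepInstance (.inst X x) (.inst Y y) (.inst Z z))

end Schema

end CausalLogic

/-! Both directions rest on describing d-connection by chains of treks. An active path from `X` to
`y ∉ Z` amounts to vertices `s 0, …, s k`, the tops, such that `s 0` has a directed path to a point
of `X` outside `Z`, `s k` has one to `y`, and consecutive tops have directed paths to a common `z i
∈ Z`. All these paths stay outside `Z` before their last vertex (`IsActivePath.exists_topReach`,
`not_dSeparated_of_topReach`).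

Soundness is the global Markov property. Among the ancestors of `X ∪ Y ∪ Z` outside `Z`, let `S₁` be
the vertices reached from `X` by such chains and `S₂` the others. Under d-separation, parents of
`S₁` lie in `S₁ ∪ Z`, parents of `S₂` in `S₂ ∪ Z`, and the parents of each vertex of `Z` in one of
these two sets. Independence of `S₁` and `S₂` given `Z` follows by transfinite induction along a
well-order extending `G` (`condIndepGiven_of_separated`): a new variable joins the side of its
parents by contraction, and moves into the condition by weak union if it is in `Z`; limit stages
reduce to finite sets. The condition is always finite, so it is handled by elementary events, while
the possibly infinite set of parents enters only through a density measurable in them.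

For completeness, take a shortest chain from some `a ∈ X` to some `b ∈ Y`, toss a fair coin at each
top, and let each vertex above `a`, `b` or some `z m` show the parity of the coins that reach it
outside `Z`. By minimality no vertex shows more than two coins, `a` and `b` show the first and the
last one, and `z m` shows coins `m` and `m + 1`. If all `z m` are even, all coins agree, so `a` and
`b` are equal yet not constant. `SCM.ofDist` realises this distribution with graph exactly `G`, and
`condIndepVars_parity` gives the Markov condition. -/

namespace CausalLogic

/-! ### d-connection through directed paths -/

section Paths

variable {V : Type u} {G : V → V → Prop} {X Y Z : Set V}

/-- `Avoids G Z s v`: there is a directed path from `s` to `v` all of whose vertices, except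
possibly `v`, lie outside `Z`. -/
def Avoids (G : V → V → Prop) (Z : Set V) : V → V → Prop :=
  Relation.ReflTransGen fun x y => G x y ∧ x ∉ Z

theorem Avoids.reach {s t : V} (h : Avoids G Z s t) : Relation.ReflTransGen G s t :=
  Relation.ReflTransGen.mono (fun _ _ h => h.1) _ _ h

theorem Avoids.eq_of_mem {s t : V} (h : Avoids G Z s t) (hs : s ∈ Z) : s = t := by
  rcases Relation.ReflTransGen.cases_head h with h | ⟨_, h, _⟩
  · exact h
  · exact absurd hs h.2

theorem Avoids.start_notMem {s t : V} (h : Avoids G Z s t) (ht : t ∉ Z) : s ∉ Z := fun hs =>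
  ht (h.eq_of_mem hs ▸ hs)

/-- Stop the path at its first vertex in `Z`. -/
theorem exists_avoids_of_reach {s z : V} (h : Relation.ReflTransGen G s z) (hz : z ∈ Z) :
    ∃ z' ∈ Z, Avoids G Z s z' := by
  induction h using Relation.ReflTransGen.head_induction_on with
  | refl => exact ⟨z, hz, .refl⟩
  | @head a c hac _ ih =>
    by_cases ha : a ∈ Z
    · exact ⟨a, ha, .refl⟩
    · obtain ⟨z', hz', h'⟩ := ih
      exact ⟨z', hz', .head ⟨hac, ha⟩ h'⟩

/-- `TopReach G Z X m s`: the vertex `s` is the top of a trek d-connected to `X` given `Z`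
through `m` vertices of `Z`. -/
inductive TopReach (G : V → V → Prop) (Z X : Set V) : ℕ → V → Prop
  | base {x s : V} : x ∈ X → x ∉ Z → s ∉ Z → Avoids G Z s x → TopReach G Z X 0 s
  | step {m : ℕ} {s t z : V} : TopReach G Z X m s → z ∈ Z → Avoids G Z s z → Avoids G Z t z →
      t ∉ Z → TopReach G Z X (m + 1) t

theorem TopReach.notMem {m : ℕ} {s : V} (h : TopReach G Z X m s) : s ∉ Z := by
  cases h <;> assumption

theorem TopReach.of_avoids {m : ℕ} {s t : V} (h : TopReach G Z X m s) (hts : Avoids G Z t s) :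
    TopReach G Z X m t := by
  have ht := hts.start_notMem h.notMem
  cases h with
  | base hx hxZ _ hs => exact .base hx hxZ ht (hts.trans hs)
  | step h hz hs h' _ => exact .step h hz hs (hts.trans h') ht

theorem IsActivePath.exists_topReach (hG : ∀ a b, G a b → ¬ G b a) {n : ℕ} {p : ℕ → V}
    (h : IsActivePath G Z n p) (h0 : p 0 ∈ X) :
    ∃ m s, TopReach G Z X m s ∧ Avoids G Z s (p n) := by
  -- Induction along the path. The second clause says that a vertex not entered by an arrow is
  -- itself a top.
  have key : ∀ i ≤ n, (∃ m s, TopReach G Z X m s ∧ Avoids G Z s (p i)) ∧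
      ((∀ j, j + 1 = i → G (p i) (p j)) → ∃ m, TopReach G Z X m (p i)) := by
    intro i
    induction i with
    | zero =>
      intro _
      have hb : TopReach G Z X 0 (p 0) := .base h0 h.start_notMem h.start_notMem .refl
      exact ⟨⟨0, p 0, hb, .refl⟩, fun _ => ⟨0, hb⟩⟩
    | succ i ih =>
      intro hi
      obtain ⟨⟨m, s, hs, hsp⟩, ih2⟩ := ih (by omega)
      rcases h.adj i hi with hg | hg
      · have hnz : p i ∉ Z := by
          cases i with
          | zero => exact h.start_notMem
          | succ i => exact h.noncollider i hi fun hc => hG _ _ hg hc.2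
        exact ⟨⟨m, s, hs, hsp.tail ⟨hg, hnz⟩⟩, fun hj => absurd (hj i rfl) (hG _ _ hg)⟩
      · have hnz : p (i + 1) ∉ Z := by
          rcases eq_or_lt_of_le hi with rfl | hlt
          · exact h.end_notMem
          · exact h.noncollider i hlt fun hc => hG _ _ hg hc.1
        have hK : ∃ m, TopReach G Z X m (p (i + 1)) := by
          -- The path goes up from `p i` to `p (i + 1)`. If no arrow entered `p i`, the current trek
          -- merely gets a higher top; otherwise `p i` is a collider, and its descendant in `Z`
          -- links the current trek to a new one with top `p (i + 1)`.
          by_cases hc : ∀ j, j + 1 = i → G (p i) (p j)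
          · obtain ⟨m, hm⟩ := ih2 hc
            exact ⟨m, hm.of_avoids (.single ⟨hg, hnz⟩)⟩
          · push Not at hc
            obtain ⟨j, rfl, hj⟩ := hc
            obtain ⟨z, hz, hr⟩ := h.collider j (by omega)
              ⟨(h.adj j (by omega)).resolve_right hj, hg⟩
            obtain ⟨z', hz', hr'⟩ := exists_avoids_of_reach hr hz
            exact ⟨_, .step hs hz' (hsp.trans hr') (.head ⟨hg, hnz⟩ hr') hnz⟩
        obtain ⟨m', hm'⟩ := hK
        exact ⟨⟨m', _, hm', .refl⟩, fun _ => ⟨m', hm'⟩⟩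
  exact (key n le_rfl).1

/-- A walk with the properties of an active path except that its vertices need not be distinct and
that its last vertex may lie in `Z`. -/
structure IsTrail (G : V → V → Prop) (Z : Set V) (n : ℕ) (p : ℕ → V) : Prop where
  adj : ∀ i < n, G (p i) (p (i + 1)) ∨ G (p (i + 1)) (p i)
  start_notMem : p 0 ∉ Z
  collider : ∀ i, i + 2 ≤ n → G (p i) (p (i + 1)) → G (p (i + 2)) (p (i + 1)) →
    ∃ z ∈ Z, Relation.ReflTransGen G (p (i + 1)) z
  noncollider : ∀ i, i + 2 ≤ n → ¬ (G (p i) (p (i + 1)) ∧ G (p (i + 2)) (p (i + 1))) →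
    p (i + 1) ∉ Z

/-- The old end becomes an inner vertex, so the collider and non-collider conditions have to be
supplied there and nowhere else. -/
theorem IsTrail.extend {n : ℕ} {p : ℕ → V} (h : IsTrail G Z n p) {w : V}
    (hadj : G (p n) w ∨ G w (p n))
    (hcol : ∀ j, j + 1 = n → G (p j) (p n) → G w (p n) →
      ∃ z ∈ Z, Relation.ReflTransGen G (p n) z)
    (hnon : ∀ j, j + 1 = n → ¬ (G (p j) (p n) ∧ G w (p n)) → p n ∉ Z) :
    IsTrail G Z (n + 1) (fun i => if i ≤ n then p i else w) := by
  refine ⟨fun i hi => ?_, by simpa using h.start_notMem, fun i hi => ?_, fun i hi => ?_⟩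
  · rcases (Nat.lt_succ_iff.1 hi).eq_or_lt with rfl | hlt
    · simpa using hadj
    · simpa [hlt.le, Nat.succ_le_iff.2 hlt] using h.adj i hlt
  · rcases Nat.lt_or_ge n (i + 2) with hlt | hle
    · obtain rfl : i + 1 = n := by omega
      simpa using hcol i rfl
    · simpa [hle, show i ≤ n by omega, show i + 1 ≤ n by omega] using h.collider i hle
  · rcases Nat.lt_or_ge n (i + 2) with hlt | hle
    · obtain rfl : i + 1 = n := by omega
      simpa using hnon i rfl
    · simpa [hle, show i ≤ n by omega, show i + 1 ≤ n by omega] using h.noncollider i hle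

/-- `v` is reached from `X` by a trail that does not end with an edge into `v`. -/
def TrailOut (G : V → V → Prop) (Z X : Set V) (v : V) : Prop :=
  ∃ n p, IsTrail G Z n p ∧ p 0 ∈ X ∧ p n = v ∧ v ∉ Z ∧ ∀ j, j + 1 = n → G v (p j)

/-- `v` is reached from `X` by a trail that ends with an edge into `v`. -/
def TrailIn (G : V → V → Prop) (Z X : Set V) (v : V) : Prop :=
  ∃ n p, IsTrail G Z (n + 1) p ∧ p 0 ∈ X ∧ p (n + 1) = v ∧ G (p n) v

theorem TrailOut.trailIn (hG : ∀ a b, G a b → ¬ G b a) {v w : V} (h : TrailOut G Z X v)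
    (hw : G v w) : TrailIn G Z X w := by
  obtain ⟨n, p, hp, h0, rfl, hv, hj⟩ := h
  exact ⟨n, _, hp.extend (.inl hw) (fun j hj' hc => absurd hc (hG _ _ (hj j hj')))
    (fun _ _ _ => hv), by simpa using h0, by simp, by simpa using hw⟩

theorem TrailIn.trailIn (hG : ∀ a b, G a b → ¬ G b a) {v w : V} (h : TrailIn G Z X v)
    (hv : v ∉ Z) (hw : G v w) : TrailIn G Z X w := by
  obtain ⟨n, p, hp, h0, rfl, hj⟩ := h
  exact ⟨n + 1, _, hp.extend (.inl hw) (fun j hj' hc hc' => absurd hc' (hG _ _ hw))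
    (fun _ _ _ => hv), by simpa using h0, by simp, by simpa using hw⟩

theorem TrailOut.trailOut (hG : ∀ a b, G a b → ¬ G b a) {v w : V} (h : TrailOut G Z X v)
    (hwZ : w ∉ Z) (hw : G w v) : TrailOut G Z X w := by
  obtain ⟨n, p, hp, h0, rfl, hv, hj⟩ := h
  refine ⟨n + 1, _, hp.extend (.inr hw) (fun j hj' hc => absurd hc (hG _ _ (hj j hj')))
    (fun _ _ _ => hv), by simpa using h0, by simp, hwZ, fun j hj => ?_⟩
  obtain rfl : j = n := by omega
  simpa using hw

theorem TrailIn.trailOut {v w : V} (h : TrailIn G Z X v) (hv : v ∈ Z)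
    (hwZ : w ∉ Z) (hw : G w v) : TrailOut G Z X w := by
  obtain ⟨n, p, hp, h0, rfl, hj⟩ := h
  refine ⟨n + 2, _, hp.extend (.inr hw) (fun _ _ _ _ => ⟨_, hv, .refl⟩)
    (fun j hj' hc => absurd ⟨by obtain rfl : j = n := by omega
                                exact hj, hw⟩ hc),
    by simpa using h0, by simp, hwZ, fun j hj => ?_⟩
  obtain rfl : j = n + 1 := by omega
  simpa using hw

theorem TrailOut.of_avoids (hG : ∀ a b, G a b → ¬ G b a) {v w : V} (h : TrailOut G Z X v)
    (hw : Avoids G Z w v) : TrailOut G Z X w := by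
  induction hw using Relation.ReflTransGen.head_induction_on with
  | refl => exact h
  | head hac _ ih => exact ih.trailOut hG hac.2 hac.1

theorem TrailOut.avoids (hG : ∀ a b, G a b → ¬ G b a) {v w : V} (h : TrailOut G Z X v)
    (hw : Avoids G Z v w) : v = w ∨ TrailIn G Z X w := by
  induction hw with
  | refl => exact .inl rfl
  | tail _ hbc ih =>
    rcases ih with rfl | ih
    · exact .inr (h.trailIn hG hbc.1)
    · exact .inr (ih.trailIn hG hbc.2 hbc.1)

/-- Climb from `x` to the first top; then repeatedly descend to `z`, which is an admissible
collider, and climb to the next top. -/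
theorem TopReach.trailOut (hG : ∀ a b, G a b → ¬ G b a) {m : ℕ} {s : V}
    (h : TopReach G Z X m s) : TrailOut G Z X s := by
  induction h with
  | @base x s hx hxZ hs hsx =>
    have : TrailOut G Z X x := ⟨0, fun _ => x, ⟨by simp, hxZ, by simp, by simp⟩, hx, rfl, hxZ,
      by simp⟩
    exact this.of_avoids hG hsx
  | @step m s t z hs hz hsz htz ht ih =>
    rcases ih.avoids hG hsz with rfl | hin
    · exact absurd hz hs.notMem
    · rcases Relation.ReflTransGen.cases_tail htz with rfl | ⟨w, htw, hwz⟩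
      · exact absurd hz ht
      · exact (hin.trailOut hz hwz.2 hwz.1).of_avoids hG htw

theorem exists_isTrail (hG : ∀ a b, G a b → ¬ G b a) {m : ℕ} {s y : V}
    (h : TopReach G Z X m s) (hy : Avoids G Z s y) :
    ∃ n p, IsTrail G Z n p ∧ p 0 ∈ X ∧ p n = y := by
  rcases (h.trailOut hG).avoids hG hy with rfl | ⟨n, p, hp, h0, hn, _⟩
  · obtain ⟨n, p, hp, h0, hn, _⟩ := h.trailOut hG
    exact ⟨n, p, hp, h0, hn⟩
  · exact ⟨_, p, hp, h0, hn⟩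

/-- A stretch of a trail that leaves its first vertex by an outgoing edge and its last vertex,
backwards, by an outgoing edge contains a collider below its first vertex. -/
theorem IsTrail.exists_collider (hG : ∀ a b, G a b → ¬ G b a) {n : ℕ} {p : ℕ → V}
    (h : IsTrail G Z n p) {j : ℕ} (hj : j + 1 ≤ n) (hout : G (p (j + 1)) (p j)) :
    ∀ d i, i + d = j → G (p i) (p (i + 1)) → ∃ z ∈ Z, Relation.ReflTransGen G (p i) z := by
  intro d
  induction d with
  | zero =>
    rintro i rfl hi
    exact absurd hout (hG _ _ hi)
  | succ d ih =>
    rintro i hij hi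
    by_cases hc : G (p (i + 2)) (p (i + 1))
    · obtain ⟨z, hz, hr⟩ := h.collider i (by omega) hi hc
      exact ⟨z, hz, .head hi hr⟩
    · obtain ⟨z, hz, hr⟩ := ih (i + 1) (by omega) ((h.adj (i + 1) (by omega)).resolve_right hc)
      exact ⟨z, hz, .head hi hr⟩

/-- Excises a closed stretch. Only the junction needs care. If it is not a collider, one of the two
remaining edges leaves it, so the corresponding visit in the old trail was already a non-collider.
If it becomes a collider, either one of the two old visits was a collider, or the stretch left and
re-entered it by outgoing edges and so contains a collider below it. -/
theorem IsTrail.cut (hG : ∀ a b, G a b → ¬ G b a) {n : ℕ} {p : ℕ → V}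
    (h : IsTrail G Z n p) {i d : ℕ} (hd : 0 < d) (hid : i + d ≤ n)
    (hp : p i = p (i + d)) :
    IsTrail G Z (n - d) (fun k => if k ≤ i then p k else p (k + d)) := by
  -- Both branches agree at `k = i`, so either formula may be used at the junction.
  have hval : ∀ k, i ≤ k → (if k ≤ i then p k else p (k + d)) = p (k + d) := by
    intro k hk
    rcases hk.eq_or_lt with rfl | hk
    · simpa using hp
    · simp [hk]
  have hval' : ∀ k, k ≤ i → (if k ≤ i then p k else p (k + d)) = p k := fun k hk => if_pos hk
  refine ⟨fun k hk => ?_, by simpa using h.start_notMem, fun k hk => ?_, fun k hk => ?_⟩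
  · rcases Nat.lt_or_ge k i with hlt | hge
    · rw [hval' k hlt.le, hval' (k + 1) hlt]
      exact h.adj k (by omega)
    · rw [hval k hge, hval (k + 1) (by omega), Nat.add_right_comm]
      exact h.adj (k + d) (by omega)
  · rcases lt_trichotomy (k + 1) i with hlt | rfl | hgt
    · rw [hval' k (by omega), hval' (k + 1) hlt.le, hval' (k + 2) hlt]
      exact h.collider k (by omega)
    · rw [hval' k (by omega), hval' (k + 1) le_rfl, hval (k + 2) (by omega)]
      intro h1 h2
      by_cases h3 : G (p (k + 2)) (p (k + 1))
      · exact h.collider k (by omega) h1 h3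
      · have h3' := (h.adj (k + 1) (by omega)).resolve_right h3
        obtain ⟨d, rfl⟩ : ∃ e, d = e + 1 := ⟨d - 1, by omega⟩
        rw [hp] at h2
        by_cases h4 : G (p (k + 1 + d)) (p (k + 1 + d + 1))
        · rw [hp]
          exact h.collider (k + 1 + d) (by omega) h4 (by convert h2 using 2 <;> omega)
        · exact h.exists_collider hG (by omega) ((h.adj (k + 1 + d) (by omega)).resolve_left h4)
            d (k + 1) rfl h3'
    · rw [hval k (by omega), hval (k + 1) (by omega), hval (k + 2) (by omega),
        show k + 1 + d = k + d + 1 by omega, show k + 2 + d = k + d + 2 by omega]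
      exact h.collider (k + d) (by omega)
  · rcases lt_trichotomy (k + 1) i with hlt | rfl | hgt
    · rw [hval' k (by omega), hval' (k + 1) hlt.le, hval' (k + 2) hlt]
      exact h.noncollider k (by omega)
    · rw [hval' k (by omega), hval' (k + 1) le_rfl, hval (k + 2) (by omega)]
      intro hc
      by_cases h1 : G (p k) (p (k + 1))
      · have h2 : ¬ G (p (k + 2 + d)) (p (k + 1)) := fun h2 => hc ⟨h1, h2⟩
        obtain ⟨d, rfl⟩ : ∃ e, d = e + 1 := ⟨d - 1, by omega⟩
        rw [hp] at h2 ⊢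
        refine h.noncollider (k + 1 + d) (by omega) fun h3 => h2 ?_
        convert h3.2 using 2 <;> omega
      · exact h.noncollider k (by omega) fun h3 => h1 h3.1
    · rw [hval k (by omega), hval (k + 1) (by omega), hval (k + 2) (by omega),
        show k + 1 + d = k + d + 1 by omega, show k + 2 + d = k + d + 2 by omega]
      exact h.noncollider (k + d) (by omega)

/-- A shortest trail has no repeated vertex, since `IsTrail.cut` would shorten it; hence it is an
active path. -/
theorem not_dSeparated_of_topReach (hG : ∀ a b, G a b → ¬ G b a) {m : ℕ} {s y : V}
    (h : TopReach G Z X m s) (hs : Avoids G Z s y) (hyZ : y ∉ Z) (hy : y ∈ Y) :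
    ¬ DSeparated G X Y Z := by
  classical
  have hex : ∃ n, ∃ p, IsTrail G Z n p ∧ p 0 ∈ X ∧ p n = y := exists_isTrail hG h hs
  obtain ⟨p, hp, h0, hn⟩ := Nat.find_spec hex
  have hmin := fun k (hk : k < Nat.find hex) => Nat.find_min hex hk
  revert hp hn hmin
  generalize Nat.find hex = n
  intro hp hn hmin hsep
  have hlt : ∀ i j, i < j → j ≤ n → p i ≠ p j := by
    intro i j hij hj hpij
    obtain ⟨d, rfl⟩ : ∃ d, j = i + d := ⟨j - i, by omega⟩
    refine hmin (n - d) (by omega) ⟨_, hp.cut hG (by omega) hj hpij, by simpa using h0, ?_⟩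
    split_ifs with hc
    · obtain rfl : n = i + d := by omega
      rw [show i + d - d = i by omega, hpij, hn]
    · rw [show n - d + d = n by omega, hn]
  refine hsep n p h0 (hn ▸ hy) ⟨fun i hi j hj hpij => ?_, hp.adj, hp.start_notMem, hn ▸ hyZ,
    fun i hi hc => hp.collider i hi hc.1 hc.2, hp.noncollider⟩
  rcases lt_trichotomy i j with hl | rfl | hl
  · exact absurd hpij (hlt i j hl hj)
  · rfl
  · exact absurd hpij.symm (hlt j i hl hi)

/-- A shortest chain of treks joining `a` and `b` given `Z`. -/
theorem exists_minimal_chain {a b : V}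
    (h : ∃ m s, TopReach G Z {a} m s ∧ Avoids G Z s b) :
    ∃ (k : ℕ) (s z : ℕ → V),
      (∀ i < k, z i ∈ Z ∧ Avoids G Z (s i) (z i) ∧ Avoids G Z (s (i + 1)) (z i)) ∧
      Avoids G Z (s 0) a ∧ Avoids G Z (s k) b ∧
      (∀ i ≤ k, Avoids G Z (s i) a → i = 0) ∧ (∀ i ≤ k, Avoids G Z (s i) b → i = k) ∧
      (∀ i ≤ k, ∀ j ≤ k, ∀ t ∈ Z, Avoids G Z (s i) t → Avoids G Z (s j) t → j ≤ i + 1) := by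
  classical
  obtain ⟨e, he, heb⟩ := Nat.find_spec h
  have hmin := fun k (hk : k < Nat.find h) => Nat.find_min h hk
  revert he hmin
  generalize Nat.find h = k
  intro he hmin
  have chain : ∀ k e, TopReach G Z {a} k e → ∃ s z : ℕ → V, s k = e ∧
      (∀ i ≤ k, TopReach G Z {a} i (s i)) ∧
      (∀ i < k, z i ∈ Z ∧ Avoids G Z (s i) (z i) ∧ Avoids G Z (s (i + 1)) (z i)) := by
    intro k
    induction k with
    | zero =>
      intro e he
      exact ⟨fun _ => e, fun _ => e, rfl, fun i hi => by simpa [Nat.le_zero.1 hi] using he, by simp⟩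
    | succ k ih =>
      intro e he
      cases he with
      | @step _ s' _ t hs' ht hst het heZ =>
        obtain ⟨s, z, hsk, hs, hz⟩ := ih s' hs'
        refine ⟨fun i => if i ≤ k then s i else e, fun i => if i < k then z i else t, by simp,
          fun i hi => ?_, fun i hi => ?_⟩
        · rcases hi.eq_or_lt with rfl | hlt
          · simpa using TopReach.step hs' ht hst het heZ
          · simpa [Nat.lt_succ_iff.1 hlt] using hs i (Nat.lt_succ_iff.1 hlt)
        · rcases (Nat.lt_succ_iff.1 hi).eq_or_lt with rfl | hlt
          · simpa [hsk] using ⟨ht, hst, het⟩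
          · simpa [hlt, hlt.le, Nat.succ_le_iff.2 hlt] using hz i hlt
  obtain ⟨s, z, rfl, hs, hz⟩ := chain k e he
  -- The rest of the chain can be appended to any other chain that arrives at `s i`.
  have push : ∀ d i m, i + d = k → TopReach G Z {a} m (s i) → TopReach G Z {a} (m + d) (s k) := by
    intro d
    induction d with
    | zero => rintro i m rfl h; exact h
    | succ d ih =>
      intro i m hid h
      obtain ⟨h1, h2, h3⟩ := hz i (by omega)
      have := ih (i + 1) (m + 1) (by omega) (.step h h1 h2 h3 (hs _ (by omega)).notMem)
      rwa [show m + (d + 1) = m + 1 + d by omega]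
  -- A quicker way to `s i` would shorten the whole chain. The remaining minimality clauses all
  -- exhibit such shortcuts.
  have level : ∀ i ≤ k, ∀ m, TopReach G Z {a} m (s i) → i ≤ m := by
    intro i hi m hm
    by_contra hlt
    exact hmin (m + (k - i)) (by omega) ⟨_, push (k - i) i m (by omega) hm, heb⟩
  have haZ : a ∉ Z := by
    cases hs 0 (Nat.zero_le _) with
    | base hx hxZ _ _ => obtain rfl := hx; exact hxZ
  refine ⟨k, s, z, hz, ?_, heb, fun i hi h => ?_, fun i hi h => ?_,
    fun i hi j hj t ht h1 h2 => ?_⟩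
  · cases hs 0 (Nat.zero_le _) with
    | base hx _ _ h' => obtain rfl := hx; exact h'
  · exact Nat.le_zero.1 (level i hi 0 (.base rfl haZ (hs i hi).notMem h))
  · by_contra hne
    exact hmin i (by omega) ⟨_, hs i hi, h⟩
  · exact level j hj (i + 1) (.step (hs i hi) ht h1 h2 (hs j hj).notMem)

end Paths

/-! ### Conditional independence given finitely many variables -/

section FiniteConditioning

variable {V : Type u} {Val : V → Type v} {A A' B B' C : Set V}

theorem comap_le_sigmaOf {X : V} (hX : X ∈ A) :
    MeasurableSpace.comap (fun s : Inst Val => s X) ⊤ ≤ sigmaOf Val A :=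
  le_iSup₂_of_le X hX le_rfl

theorem sigmaOf_mono (h : A ⊆ A') : sigmaOf Val A ≤ sigmaOf Val A' :=
  biSup_mono h

theorem sigmaOf_le (A : Set V) : sigmaOf Val A ≤ (inferInstance : MeasurableSpace (Inst Val)) :=
  iSup₂_le fun X _ => le_iSup (fun X => MeasurableSpace.comap (fun s : Inst Val => s X) ⊤) X

theorem measurableSet_sigmaOf_eval {X : V} (hX : X ∈ A) (x : Val X) :
    MeasurableSet[sigmaOf Val A] {s : Inst Val | s X = x} :=
  comap_le_sigmaOf hX _ ⟨{x}, trivial, rfl⟩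

/-- The event that the variables in `C` have the values they have in `s₀`. -/
def agree (C : Set V) (s₀ : Inst Val) : Set (Inst Val) := {s | ∀ W ∈ C, s W = s₀ W}

theorem measurableSet_sigmaOf_agree (hC : C.Finite) (s₀ : Inst Val) :
    MeasurableSet[sigmaOf Val C] (agree C s₀) := by
  have : agree C s₀ = ⋂ W ∈ C, {s : Inst Val | s W = s₀ W} := by
    ext s
    simp [agree]
  rw [this]
  exact MeasurableSet.biInter hC.countable fun W hW => measurableSet_sigmaOf_eval hW _

theorem measurableSet_agree (hC : C.Finite) (s₀ : Inst Val) : MeasurableSet (agree C s₀) :=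
  sigmaOf_le C _ (measurableSet_sigmaOf_agree hC s₀)

theorem agree_union (C D : Set V) (s₀ : Inst Val) :
    agree (C ∪ D) s₀ = agree C s₀ ∩ agree D s₀ := by
  ext s
  simp only [agree, Set.mem_union, Set.mem_ofPred_eq, Set.mem_inter_iff, or_imp, forall_and]

/-- The variables in `A` are independent of those in `B` conditionally on each instantiation of the
variables in `C`. -/
def CondIndepGiven (μ : Measure (Inst Val)) (A B C : Set V) : Prop :=
  ∀ s₀ : Inst Val, Indep (sigmaOf Val A) (sigmaOf Val B) μ[|agree C s₀]

variable {μ : Measure (Inst Val)}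

theorem CondIndepGiven.symm (h : CondIndepGiven μ A B C) : CondIndepGiven μ B A C :=
  fun s₀ => (h s₀).symm

theorem CondIndepGiven.mono (h : CondIndepGiven μ A B C) (hA : A' ⊆ A) (hB : B' ⊆ B) :
    CondIndepGiven μ A' B' C := fun s₀ =>
  indep_of_indep_of_le_right (indep_of_indep_of_le_left (h s₀) (sigmaOf_mono hA)) (sigmaOf_mono hB)

/-- Clearing denominators makes the criterion valid for null `c` too, where both sides hold
trivially. -/
theorem indep_cond_iff {Ω : Type*} {m₁ m₂ m : MeasurableSpace Ω} (μ : Measure Ω)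
    [IsFiniteMeasure μ] {c : Set Ω} (hc : MeasurableSet c) :
    Indep m₁ m₂ μ[|c] ↔ ∀ a b, MeasurableSet[m₁] a → MeasurableSet[m₂] b →
      μ (c ∩ (a ∩ b)) * μ c = μ (c ∩ a) * μ (c ∩ b) := by
  rw [Indep_iff]
  refine forall₄_congr fun a b ha hb => ?_
  simp only [cond_apply hc]
  by_cases h0 : μ c = 0
  · simp [h0, measure_mono_null (Set.inter_subset_left (s := c)) h0]
  · have hT : μ c ≠ ⊤ := measure_ne_top μ c
    constructor
    · intro h
      calc μ (c ∩ (a ∩ b)) * μ c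
          = ((μ c)⁻¹ * μ (c ∩ (a ∩ b))) * (μ c * μ c) := by
            rw [mul_comm (μ c)⁻¹, mul_assoc, ← mul_assoc (μ c)⁻¹, ENNReal.inv_mul_cancel h0 hT,
              one_mul]
        _ = (((μ c)⁻¹ * μ c) * μ (c ∩ a)) * (((μ c)⁻¹ * μ c) * μ (c ∩ b)) := by rw [h]; ring
        _ = _ := by simp [ENNReal.inv_mul_cancel h0 hT]
    · intro h
      calc (μ c)⁻¹ * μ (c ∩ (a ∩ b))
          = (μ c)⁻¹ * (μ (c ∩ (a ∩ b)) * μ c) * (μ c)⁻¹ := by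
            rw [mul_assoc, mul_assoc, ENNReal.mul_inv_cancel h0 hT, mul_one]
        _ = _ := by rw [h]; ring

/-- Cylinder events form a generating π-system, and each involves only finitely many variables. -/
theorem CondIndepGiven.of_finite [IsFiniteMeasure μ]
    (h : ∀ F₁ F₂ : Finset V, (F₁ : Set V) ⊆ A → (F₂ : Set V) ⊆ B → CondIndepGiven μ F₁ F₂ C) :
    CondIndepGiven μ A B C := by
  intro s₀
  let π : V → Set (Set (Inst Val)) := fun X =>
    {t | MeasurableSet[MeasurableSpace.comap (fun s : Inst Val => s X) ⊤] t}
  have hπ : ∀ S : Set V, IsPiSystem (piiUnionInter π S) := fun S =>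
    isPiSystem_piiUnionInter π (fun X => @MeasurableSpace.isPiSystem_measurableSet _ (_)) S
  refine IndepSets.indep (sigmaOf_le A) (sigmaOf_le B) (hπ A) (hπ B)
    (generateFrom_piiUnionInter_measurableSet _ A).symm
    (generateFrom_piiUnionInter_measurableSet _ B).symm ?_
  rw [IndepSets_iff]
  rintro _ _ ⟨F₁, hF₁, f₁, hf₁, rfl⟩ ⟨F₂, hF₂, f₂, hf₂, rfl⟩
  refine (Indep_iff _ _ _).1 (h F₁ F₂ hF₁ hF₂ s₀) _ _ ?_ ?_
  · exact Finset.measurableSet_biInter _ fun X hX => comap_le_sigmaOf hX _ (hf₁ X hX)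
  · exact Finset.measurableSet_biInter _ fun X hX => comap_le_sigmaOf hX _ (hf₂ X hX)

/-- Weak union. -/
theorem CondIndepGiven.weakUnion [IsFiniteMeasure μ] {X : V} (hC : C.Finite)
    (h : CondIndepGiven μ A B C) (hX : X ∈ A) : CondIndepGiven μ A B (insert X C) := by
  intro s₀
  have hD : agree (insert X C) s₀ = agree C s₀ ∩ {s | s X = s₀ X} := by
    rw [Set.insert_eq, Set.union_comm, agree_union]
    simp [agree]
  have hx := measurableSet_sigmaOf_eval (Val := Val) hX (s₀ X)
  have hc := measurableSet_agree hC s₀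
  rw [hD, indep_cond_iff μ (hc.inter (sigmaOf_le _ _ hx))]
  intro a b ha hb
  have key := (indep_cond_iff μ hc).1 (h s₀)
  set c := agree C s₀
  set x := {s : Inst Val | s X = s₀ X}
  -- As `X ∈ A`, the event `x` can be moved from the condition into the event about `A`.
  have h1 := key (x ∩ a) b (hx.inter ha) hb
  have h2 := key x b hx hb
  by_cases h0 : μ c = 0
  · have h0' : μ (c ∩ x) = 0 := measure_mono_null Set.inter_subset_left h0
    have h0'' : μ (c ∩ x ∩ a) = 0 := measure_mono_null Set.inter_subset_left h0'
    rw [h0', h0'']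
    simp
  · have hT : μ c ≠ ⊤ := measure_ne_top μ c
    rw [← ENNReal.mul_left_inj h0 hT]
    calc μ (c ∩ x ∩ (a ∩ b)) * μ (c ∩ x) * μ c
        = (μ (c ∩ (x ∩ a ∩ b)) * μ c) * μ (c ∩ x) := by
          rw [show c ∩ x ∩ (a ∩ b) = c ∩ (x ∩ a ∩ b) by simp only [Set.inter_assoc]]; ring
      _ = μ (c ∩ (x ∩ a)) * (μ (c ∩ x) * μ (c ∩ b)) := by rw [h1]; ring
      _ = μ (c ∩ x ∩ a) * μ (c ∩ x ∩ b) * μ c := by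
          rw [← h2, ← Set.inter_assoc, ← Set.inter_assoc]; ring

open Classical in
/-- Events about `A ∪ C` are, given an instantiation of `C`, events about `A`. -/
theorem indep_sigmaOf_union [IsFiniteMeasure μ] (hC : C.Finite) (h : CondIndepGiven μ A B C)
    (s₀ : Inst Val) : Indep (sigmaOf Val (A ∪ C)) (sigmaOf Val B) μ[|agree C s₀] := by
  have hc := measurableSet_agree hC s₀
  -- Overwriting the coordinates in `C` turns events about `A ∪ C` into events about `A` and changes
  -- nothing on `agree C s₀`.
  let o : Inst Val → Inst Val := fun s W => if W ∈ C then s₀ W else s W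
  have ho : Measurable[sigmaOf Val A, sigmaOf Val (A ∪ C)] o := by
    rw [measurable_iff_comap_le]
    simp only [MeasurableSpace.comap_iSup, MeasurableSpace.comap_comp]
    refine iSup₂_le fun W hW => ?_
    by_cases hWC : W ∈ C
    · have : (fun s : Inst Val => s W) ∘ o = fun _ => s₀ W :=
        funext fun s => if_pos hWC
      rw [this, MeasurableSpace.comap_const]
      exact bot_le
    · have : (fun s : Inst Val => s W) ∘ o = fun s => s W :=
        funext fun s => if_neg hWC
      rw [this]
      exact comap_le_sigmaOf (hW.resolve_right hWC)
  have hoc : ∀ s ∈ agree C s₀, o s = s := by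
    intro s hs
    funext W
    by_cases hWC : W ∈ C
    · simp [o, hWC, hs W hWC]
    · simp [o, hWC]
  have hpre : ∀ a b : Set (Inst Val), agree C s₀ ∩ (o ⁻¹' a ∩ b) = agree C s₀ ∩ (a ∩ b) := by
    intro a b
    ext s
    refine and_congr_right fun hs => ?_
    simp [hoc s hs]
  rw [indep_cond_iff μ hc]
  intro a b ha hb
  have key := (indep_cond_iff μ hc).1 (h s₀) (o ⁻¹' a) b (ho ha) hb
  have h' := hpre a Set.univ
  simp only [Set.inter_univ] at h'
  rwa [hpre, h'] at key

/-- The local Markov property represents the conditional probability of an event about `A`, given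
the variables in `B`, by a function of the variables in `C`. -/
theorem CondIndepVars.exists_density [IsProbabilityMeasure μ] (h : CondIndepVars μ A B C)
    {a : Set (Inst Val)} (ha : MeasurableSet[sigmaOf Val A] a) :
    ∃ g : Inst Val → ENNReal, Measurable[sigmaOf Val C] g ∧
      ∀ b, MeasurableSet[sigmaOf Val B] b → μ (a ∩ b) = ∫⁻ s in b, g s ∂μ := by
  have hC : sigmaOf Val C ≤ (inferInstance : MeasurableSpace (Inst Val)) := sigmaOf_le C
  have ha' : MeasurableSet a := sigmaOf_le A _ ha
  set g₀ : Inst Val → ℝ := μ⟦a | sigmaOf Val C⟧ with hg₀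
  have hsm : StronglyMeasurable[sigmaOf Val C] g₀ := stronglyMeasurable_condExp
  refine ⟨fun s => ENNReal.ofReal (g₀ s), hsm.measurable.ennreal_ofReal, fun b hb => ?_⟩
  have hb' : MeasurableSet b := sigmaOf_le B _ hb
  have hint : Integrable g₀ μ := integrable_condExp
  have hnn : 0 ≤ᵐ[μ] g₀ := condExp_nonneg (ae_of_all _ fun s => Set.indicator_nonneg (by simp) s)
  have hone : ∀ t : Set (Inst Val), MeasurableSet t →
      Integrable (t.indicator fun _ => (1 : ℝ)) μ := fun t ht =>
    (integrable_const (1 : ℝ)).indicator ht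
  have hprod : g₀ * (b.indicator fun _ => (1 : ℝ)) = b.indicator g₀ := by
    ext s
    by_cases hs : s ∈ b <;> simp [hs]
  have hreal : μ.real (a ∩ b) = ∫ s in b, g₀ s ∂μ := by
    calc μ.real (a ∩ b) = ∫ s, (a ∩ b).indicator (fun _ => (1 : ℝ)) s ∂μ := by
          rw [integral_indicator (ha'.inter hb')]; simp
      _ = ∫ s, (μ⟦a ∩ b | sigmaOf Val C⟧) s ∂μ := (integral_condExp hC).symm
      _ = ∫ s, (g₀ * μ⟦b | sigmaOf Val C⟧) s ∂μ := integral_congr_ae (h a b ha hb)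
      -- The factor `g₀` is measurable for the conditioning σ-algebra, so it can be pulled inside.
      _ = ∫ s, (μ[g₀ * (b.indicator fun _ => (1 : ℝ)) | sigmaOf Val C]) s ∂μ :=
          integral_congr_ae (condExp_mul_of_stronglyMeasurable_left hsm
            (hprod ▸ hint.indicator hb') (hone b hb')).symm
      _ = ∫ s, b.indicator g₀ s ∂μ := by rw [integral_condExp hC, hprod]
      _ = ∫ s in b, g₀ s ∂μ := integral_indicator hb'
  rw [← ofReal_integral_eq_lintegral_ofReal hint.integrableOn (ae_restrict_of_ae hnn), ← hreal,
    ofReal_measureReal]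

/-- Contraction. -/
theorem CondIndepGiven.contraction [IsProbabilityMeasure μ] {X : V} {N P : Set V} (hC : C.Finite)
    (h : CondIndepGiven μ A B C) (hX : CondIndepVars μ {X} N P) (hP : P ⊆ A ∪ C)
    (hA : A ⊆ N) (hB : B ⊆ N) (hCN : C ⊆ N) : CondIndepGiven μ (insert X A) B C := by
  classical
  intro s₀
  have hc := measurableSet_agree hC s₀
  have hcN := sigmaOf_mono hCN _ (measurableSet_sigmaOf_agree hC s₀)
  let π : V → Set (Set (Inst Val)) := fun X =>
    {t | MeasurableSet[MeasurableSpace.comap (fun s : Inst Val => s X) ⊤] t}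
  refine IndepSets.indep (sigmaOf_le _) (sigmaOf_le B)
    (isPiSystem_piiUnionInter π (fun X => @MeasurableSpace.isPiSystem_measurableSet _ (_)) _)
    (@MeasurableSpace.isPiSystem_measurableSet _ (sigmaOf Val B))
    (generateFrom_piiUnionInter_measurableSet _ (insert X A)).symm
    (@MeasurableSpace.generateFrom_measurableSet _ (sigmaOf Val B)).symm ?_
  rw [IndepSets_iff]
  rintro _ b ⟨F, hF, f, hf, rfl⟩ hb
  -- Each cylinder about `insert X A` splits into an event about `X` and one about `A`.
  obtain ⟨e, a, he, ha, hea⟩ : ∃ e a, MeasurableSet[sigmaOf Val {X}] e ∧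
      MeasurableSet[sigmaOf Val A] a ∧ ⋂ x ∈ F, f x = e ∩ a := by
    refine ⟨if X ∈ F then f X else Set.univ, ⋂ x ∈ F.erase X, f x, ?_, ?_, ?_⟩
    · split_ifs with hXF
      · exact comap_le_sigmaOf (Set.mem_singleton X) _ (hf X hXF)
      · exact MeasurableSet.univ
    · refine Finset.measurableSet_biInter _ fun W hW => ?_
      have hW' := Finset.mem_erase.1 hW
      exact comap_le_sigmaOf ((hF hW'.2).resolve_left hW'.1) _ (hf W hW'.2)
    · split_ifs with hXF
      · rw [← Finset.insert_erase hXF, Finset.set_biInter_insert, Finset.erase_insert_eq_erase]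
        simp
      · rw [Finset.erase_eq_of_notMem hXF, Set.univ_inter]
  rw [hea]
  obtain ⟨g, hg, hgb⟩ := hX.exists_density he
  -- `g` remains a density after conditioning, because `agree C s₀` is itself an event about `N`.
  have hνb : ∀ b, MeasurableSet[sigmaOf Val N] b →
      μ[|agree C s₀] (e ∩ b) = ∫⁻ s in b, g s ∂μ[|agree C s₀] := by
    intro b hb
    rw [cond_apply hc, ProbabilityTheory.cond, Measure.restrict_smul, lintegral_smul_measure,
      Measure.restrict_restrict (sigmaOf_le _ _ hb), smul_eq_mul,
      show agree C s₀ ∩ (e ∩ b) = e ∩ (b ∩ agree C s₀) by ext; simp; tauto, hgb _ (hb.inter hcN)]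
  have hbN := sigmaOf_mono hB _ hb
  have haN := sigmaOf_mono hA _ ha
  have haAC := sigmaOf_mono (Set.subset_union_left (t := C)) _ ha
  -- Since `P ⊆ A ∪ C`, this function is independent of `b` given `C`, and the integral over `a ∩ b`
  -- factors.
  have hgAC : Measurable[sigmaOf Val (A ∪ C)] (a.indicator g) :=
    (hg.mono (sigmaOf_mono hP) le_rfl).indicator haAC
  have hind := indep_sigmaOf_union hC h s₀
  have hb1 : Measurable[sigmaOf Val B] (b.indicator (1 : Inst Val → ENNReal)) :=
    (@measurable_const ENNReal (Inst Val) _ (sigmaOf Val B) 1).indicator hb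
  rw [Set.inter_assoc, hνb _ (haN.inter hbN), hνb _ haN]
  have := lintegral_mul_eq_lintegral_mul_lintegral_of_independent_measurableSpace
    (sigmaOf_le _) (sigmaOf_le B) hind hgAC hb1
  rw [lintegral_indicator_one (sigmaOf_le _ _ hb), lintegral_indicator (sigmaOf_le _ _ ha)] at this
  rw [← this, ← lintegral_indicator ((sigmaOf_le _ _ ha).inter (sigmaOf_le _ _ hb))]
  refine lintegral_congr fun s => ?_
  by_cases h1 : s ∈ a <;> by_cases h2 : s ∈ b <;> simp [h1, h2]

end FiniteConditioning

/-! ### The global Markov property -/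

section GlobalMarkov

variable {V : Type u} {Val : V → Type v} [LinearOrder V] {G : V → V → Prop}
  {μ : Measure (Inst Val)} [IsProbabilityMeasure μ] {S₁ S₂ C : Set V}

/-- The limit step of the induction: finitely many variables of `D`, together with all of `C ∩ D`,
lie below their maximum `m ∈ D`, where the condition is already the full one. -/
theorem condIndepGiven_inter_of_forall_Iic (hC : C.Finite) {D : Set V}
    (hD : IsLowerSet D)
    (h : ∀ m ∈ D, CondIndepGiven μ (S₁ ∩ Set.Iic m) (S₂ ∩ Set.Iic m) (C ∩ Set.Iic m)) :
    CondIndepGiven μ (S₁ ∩ D) (S₂ ∩ D) (C ∩ D) := by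
  refine CondIndepGiven.of_finite fun F₁ F₂ hF₁ hF₂ => ?_
  have hfin : ((F₁ : Set V) ∪ F₂ ∪ (C ∩ D)).Finite :=
    (F₁.finite_toSet.union F₂.finite_toSet).union (hC.inter_of_left D)
  rcases Set.eq_empty_or_nonempty ((F₁ : Set V) ∪ F₂ ∪ (C ∩ D)) with he | hne
  · simp only [Set.union_empty_iff] at he
    rw [he.1.1, he.1.2]
    intro s₀
    simp only [sigmaOf, Set.mem_empty_iff_false, iSup_false, iSup_bot]
    exact indep_bot_left _
  · obtain ⟨m, hm, hmax⟩ := Set.exists_max_image _ id hfin hne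
    have hmD : m ∈ D := by
      rcases hm with (hm | hm) | hm
      exacts [(hF₁ hm).2, (hF₂ hm).2, hm.2]
    have hCm : C ∩ D = C ∩ Set.Iic m := by
      ext x
      exact and_congr_right fun hx =>
        ⟨fun hxD => hmax x (.inr ⟨hx, hxD⟩), fun hxm => hD hxm hmD⟩
    rw [hCm]
    exact (h m hmD).mono (fun x hx => ⟨(hF₁ hx).1, hmax x (.inl (.inl hx))⟩)
      fun x hx => ⟨(hF₂ hx).1, hmax x (.inl (.inr hx))⟩

/-- The local Markov property implies that sets of variables whose union with the finite set `C` is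
closed under parents, and no two members of which are adjacent or have a common child, are
independent given `C`. -/
theorem condIndepGiven_of_separated [WellFoundedLT V] (hG : ∀ a b, G a b → a < b)
    (hμ : ∀ X, CondIndepVars μ {X} {Y | ¬ Relation.ReflTransGen G X Y} {Y | G Y X})
    (hC : C.Finite) (h12 : Disjoint S₁ S₂) (h1C : Disjoint S₁ C) (h2C : Disjoint S₂ C)
    (h1 : ∀ X ∈ S₁, ∀ W, G W X → W ∈ S₁ ∪ C) (h2 : ∀ X ∈ S₂, ∀ W, G W X → W ∈ S₂ ∪ C)
    (h3 : ∀ X ∈ C, (∀ W, G W X → W ∈ S₁ ∪ C) ∨ ∀ W, G W X → W ∈ S₂ ∪ C) :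
    CondIndepGiven μ S₁ S₂ C := by
  have hdesc : ∀ {X Y}, Relation.ReflTransGen G X Y → X ≤ Y := by
    intro X Y h
    induction h with
    | refl => exact le_rfl
    | tail _ h ih => exact ih.trans (hG _ _ h).le
  -- Everything below `X` is a non-descendant, so the local Markov property applies to it.
  have hIio : ∀ (S : Set V) (X : V),
      S ∩ Set.Iio X ⊆ {Y | ¬ Relation.ReflTransGen G X Y} := fun S X Y hY hr =>
    (hdesc hr).not_gt hY.2
  have hin : ∀ (S : Set V) (X : V), X ∈ S → S ∩ Set.Iic X = insert X (S ∩ Set.Iio X) := by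
    intro S X hX
    rw [← Set.Iio_insert, Set.inter_insert_of_mem hX]
  have hout : ∀ (S : Set V) (X : V), X ∉ S → S ∩ Set.Iic X = S ∩ Set.Iio X := by
    intro S X hX
    rw [← Set.Iio_insert, Set.inter_insert_of_notMem hX]
  have hpar : ∀ {S T : Set V} {X : V}, (∀ W, G W X → W ∈ S ∪ T) →
      {W | G W X} ⊆ S ∩ Set.Iio X ∪ T ∩ Set.Iio X := by
    intro S T X h W hW
    rw [← Set.union_inter_distrib_right]
    exact ⟨h W hW, hG _ _ hW⟩
  have step : ∀ X, CondIndepGiven μ (S₁ ∩ Set.Iio X) (S₂ ∩ Set.Iio X) (C ∩ Set.Iio X) →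
      CondIndepGiven μ (S₁ ∩ Set.Iic X) (S₂ ∩ Set.Iic X) (C ∩ Set.Iic X) := by
    intro X ih
    have hfin := hC.inter_of_left (Set.Iio X)
    have ins1 (h : ∀ W, G W X → W ∈ S₁ ∪ C) := ih.contraction hfin (hμ X) (hpar h) (hIio _ _)
      (hIio _ _) (hIio _ _)
    have ins2 (h : ∀ W, G W X → W ∈ S₂ ∪ C) := ih.symm.contraction hfin (hμ X) (hpar h) (hIio _ _)
      (hIio _ _) (hIio _ _)
    by_cases hX1 : X ∈ S₁
    · rw [hin S₁ X hX1, hout S₂ X (h12.notMem_of_mem_left hX1),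
        hout C X (h1C.notMem_of_mem_left hX1)]
      exact ins1 (h1 X hX1)
    rw [hout S₁ X hX1]
    by_cases hX2 : X ∈ S₂
    · rw [hin S₂ X hX2, hout C X (h2C.notMem_of_mem_left hX2)]
      exact (ins2 (h2 X hX2)).symm
    rw [hout S₂ X hX2]
    -- Contraction first adds `X` to the side containing its parents; weak union then moves it into
    -- the condition.
    by_cases hXC : X ∈ C
    · rw [hin C X hXC]
      rcases h3 X hXC with h | h
      · exact ((ins1 h).weakUnion hfin (Set.mem_insert _ _)).mono (Set.subset_insert _ _) le_rfl
      · exact (((ins2 h).weakUnion hfin (Set.mem_insert _ _)).mono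
          (Set.subset_insert _ _) le_rfl).symm
    · rwa [hout C X hXC]
  have key : ∀ X, CondIndepGiven μ (S₁ ∩ Set.Iio X) (S₂ ∩ Set.Iio X) (C ∩ Set.Iio X) := by
    intro X
    induction X using WellFoundedLT.induction with
    | _ X ih =>
      exact condIndepGiven_inter_of_forall_Iic hC (isLowerSet_Iio X) fun m hm => step m (ih m hm)
  simpa using condIndepGiven_inter_of_forall_Iic hC isLowerSet_univ fun m _ => step m (key m)

end GlobalMarkov

/-! ### Measurable models -/

section MeasurableModels

variable {V : Type u} {Val : V → Type v} [∀ X, Nontrivial (Val X)]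

theorem SCM.IsMeasurable.measurable_solution {M : SCM.{u, v, w, w'} Val} (h : M.IsMeasurable) :
    Measurable M.solution :=
  h (fun _ => none) (by simp)

theorem SCM.IsMeasurable.isProbabilityMeasure_jointDist {M : SCM.{u, v, w, w'} Val}
    (h : M.IsMeasurable) : IsProbabilityMeasure M.jointDist :=
  Measure.isProbabilityMeasure_map h.measurable_solution.aemeasurable

end MeasurableModels

/-! ### Semantics of the conditional independence schema -/

section SchemaSemantics

variable {V : Type u} {Val : V → Type v} [Nonempty V] [∀ X, Nontrivial (Val X)]

theorem PropFormula.holds_top (s : Inst Val) : (PropFormula.top : PropFormula Val).Holds s := by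
  simp [PropFormula.top, PropFormula.Holds]

theorem PropFormula.holds_conj (s : Inst Val) (l : List (PropFormula Val)) :
    (PropFormula.conj l).Holds s ↔ ∀ φ ∈ l, φ.Holds s := by
  induction l with
  | nil => simpa [PropFormula.conj] using PropFormula.holds_top s
  | cons φ l ih =>
    rw [List.forall_mem_cons, ← ih]
    exact Iff.rfl

theorem PropFormula.holds_inst (s : Inst Val) (X : Finset V) (x : ∀ W : X, Val W) :
    (PropFormula.inst X x).Holds s ↔ ∀ W : X, s W = x W := by
  simp only [PropFormula.inst, PropFormula.holds_conj, List.mem_map, Finset.mem_toList,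
    Finset.mem_univ, true_and]
  exact Set.forall_mem_range

theorem L1.holds_conj (M : SCM.{u, v, w, w'} Val) (l : List (L1 Val)) :
    (L1.conj l).Holds M ↔ ∀ φ ∈ l, φ.Holds M := by
  induction l with
  | nil => simp [L1.conj, L1.Holds]
  | cons φ l ih =>
    rw [List.forall_mem_cons, ← ih]
    exact Iff.rfl

variable [∀ X, Finite (Val X)]

theorem holds_condIndepSchema (M : SCM.{u, v, w, w'} Val) (X Y Z : Finset V) :
    (condIndepSchema Val X Y Z).Holds M ↔
      ∀ (x : ∀ W : X, Val W) (y : ∀ W : Y, Val W) (z : ∀ W : Z, Val W),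
        M.prob.real {e | ((∀ W : X, M.solution e W = x W) ∧ ∀ W : Y, M.solution e W = y W) ∧
            ∀ W : Z, M.solution e W = z W} *
          M.prob.real {e | ∀ W : Z, M.solution e W = z W} =
        M.prob.real {e | (∀ W : X, M.solution e W = x W) ∧ ∀ W : Z, M.solution e W = z W} *
          M.prob.real {e | (∀ W : Y, M.solution e W = y W) ∧ ∀ W : Z, M.solution e W = z W} := by
  have hinst : ∀ x y z : PropFormula Val, (condIndepInstance x y z).Holds M ↔
      M.prob.real {e | (x.Holds (M.solution e) ∧ y.Holds (M.solution e)) ∧ z.Holds (M.solution e)} *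
        M.prob.real {e | z.Holds (M.solution e)} =
      M.prob.real {e | x.Holds (M.solution e) ∧ z.Holds (M.solution e)} *
        M.prob.real {e | y.Holds (M.solution e) ∧ z.Holds (M.solution e)} := fun x y z => by
    simp only [condIndepInstance, L1.eqv, L1.Holds, ProbTerm.eval, PropFormula.Holds]
    exact le_antisymm_iff.symm.trans eq_comm
  have hmem : ∀ (S : Finset V) (x : ∀ W : S, Val W), x ∈ allInst S := fun S x => by
    simp [allInst]
  simp only [condIndepSchema, L1.holds_conj, List.mem_flatMap, List.mem_map, hmem, true_and]
  constructor
  · intro h x y z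
    simpa only [hinst, PropFormula.holds_inst] using h _ ⟨x, y, z, rfl⟩
  · rintro h _ ⟨x, y, z, rfl⟩
    simpa only [hinst, PropFormula.holds_inst] using h x y z

end SchemaSemantics

/-! ### Soundness -/

section Soundness

variable {V : Type u} {Val : V → Type v}

theorem exists_avoids_of_ancestor {G : V → V → Prop} {T Z : Set V} {v t : V} (ht : t ∈ T)
    (h : Relation.ReflTransGen G v t) :
    (∃ z ∈ Z, Avoids G Z v z) ∨ ∃ t ∈ T, t ∉ Z ∧ Avoids G Z v t := by
  induction h using Relation.ReflTransGen.head_induction_on with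
  | refl =>
    by_cases h : t ∈ Z
    exacts [.inl ⟨t, h, .refl⟩, .inr ⟨t, ht, h, .refl⟩]
  | @head a c hac _ ih =>
    by_cases ha : a ∈ Z
    · exact .inl ⟨a, ha, .refl⟩
    · exact ih.imp (fun ⟨z, hz, h⟩ => ⟨z, hz, .head ⟨hac, ha⟩ h⟩)
        fun ⟨z, hz, hz', h⟩ => ⟨z, hz, hz', .head ⟨hac, ha⟩ h⟩

/-- The global Markov property, for finitely many conditioning variables. -/
theorem condIndepGiven_of_dSeparated {G : V → V → Prop} (hG : WellFounded G)
    {μ : Measure (Inst Val)} [IsProbabilityMeasure μ]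
    (hμ : ∀ X, CondIndepVars μ {X} {Y | ¬ Relation.ReflTransGen G X Y} {Y | G Y X})
    {X Y Z : Set V} (hZ : Z.Finite) (hsep : DSeparated G X Y Z) :
    CondIndepGiven μ X Y Z := by
  have hasymm : ∀ a b, G a b → ¬ G b a := fun a b h h' => hG.asymmetric _ _ h h'
  let A : Set V := {v | ∃ t ∈ X ∪ Y ∪ Z, Relation.ReflTransGen G v t}
  have hA : ∀ v ∈ A, ∀ w, G w v → w ∈ A := fun v ⟨t, ht, h⟩ w hw => ⟨t, ht, .head hw h⟩
  let S₁ : Set V := {v | (v ∈ A ∧ v ∉ Z) ∧ ∃ m s, TopReach G Z X m s ∧ Avoids G Z s v}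
  let S₂ : Set V := {v | (v ∈ A ∧ v ∉ Z) ∧ v ∉ S₁}
  have hZA : ∀ z ∈ Z, z ∈ A := fun z hz => ⟨z, .inr hz, .refl⟩
  have hself : ∀ {m v}, v ∈ A → TopReach G Z X m v → v ∈ S₁ := fun hv h =>
    ⟨⟨hv, h.notMem⟩, _, _, h, .refl⟩
  obtain ⟨r, hr, hwo⟩ :=
    have : IsWellFounded V G := ⟨hG⟩
    IsWellFounded.exists_well_order_ge G
  classical
  let _ : LinearOrder V := linearOrderOfSTO r
  have : WellFoundedLT V := ⟨hwo.wf⟩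
  have main : CondIndepGiven μ S₁ S₂ Z := by
    refine condIndepGiven_of_separated (fun a b h => hr a b h) hμ hZ ?_ ?_ ?_ ?_ ?_ ?_
    · exact Set.disjoint_left.2 fun v h1 h2 => h2.2 h1
    · exact Set.disjoint_left.2 fun v h1 h2 => h1.1.2 h2
    · exact Set.disjoint_left.2 fun v h1 h2 => h1.1.2 h2
    · rintro v ⟨⟨hvA, hvZ⟩, m, s, hs, hsv⟩ w hw
      by_cases hwZ : w ∈ Z
      · exact .inr hwZ
      refine .inl ?_
      have hwA := hA v hvA w hw
      have hwv : Avoids G Z w v := .single ⟨hw, hwZ⟩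
      obtain ⟨t, ht, hvt⟩ := hvA
      -- Below `v` the path first meets `Z`, which opens a collider for `w`, or ends in `X`, which
      -- makes `w` a first top, or ends in `Y`, contradicting d-separation.
      rcases exists_avoids_of_ancestor (Z := Z) ht hvt with ⟨z, hz, hvz⟩ | ⟨t, (ht | ht) | ht, htZ, hvt⟩
      · exact hself hwA (.step hs hz (hsv.trans hvz) (hwv.trans hvz) hwZ)
      · exact hself hwA (.base ht htZ hwZ (hwv.trans hvt))
      · exact absurd hsep (not_dSeparated_of_topReach hasymm hs (hsv.trans hvt) htZ ht)
      · exact absurd ht htZ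
    · rintro v ⟨⟨hvA, hvZ⟩, hv⟩ w hw
      by_cases hwZ : w ∈ Z
      · exact .inr hwZ
      refine .inl ⟨⟨hA v hvA w hw, hwZ⟩, ?_⟩
      rintro ⟨_, m, s, hs, hsw⟩
      exact hv ⟨⟨hvA, hvZ⟩, m, s, hs, hsw.tail ⟨hw, hwZ⟩⟩
    · intro v hv
      -- One parent in `S₁` pulls all parents outside `Z` into `S₁`, through the collider `v`.
      by_cases h : ∃ w, G w v ∧ w ∈ S₁
      · obtain ⟨w, hw, ⟨_, hwZ⟩, m, s, hs, hsw⟩ := h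
        refine .inl fun w' hw' => ?_
        by_cases hwZ' : w' ∈ Z
        · exact .inr hwZ'
        · exact .inl (hself (hA v (hZA v hv) w' hw')
            (.step hs hv (hsw.tail ⟨hw, hwZ⟩) (.single ⟨hw', hwZ'⟩) hwZ'))
      · push Not at h
        refine .inr fun w hw => ?_
        by_cases hwZ : w ∈ Z
        · exact .inr hwZ
        · exact .inl ⟨⟨hA v (hZA v hv) w hw, hwZ⟩, h w hw⟩
  -- `X` and `Y` may meet `Z`, so `Z` is added to both sides.
  have main' : CondIndepGiven μ (S₁ ∪ Z) (S₂ ∪ Z) Z := by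
    have h1 : CondIndepGiven μ (S₁ ∪ Z) S₂ Z := indep_sigmaOf_union hZ main
    have h2 : CondIndepGiven μ (S₂ ∪ Z) (S₁ ∪ Z) Z := indep_sigmaOf_union hZ h1.symm
    exact h2.symm
  refine main'.mono (fun x hx => ?_) fun y hy => ?_
  · by_cases hxZ : x ∈ Z
    · exact .inr hxZ
    · exact .inl (hself ⟨x, .inl (.inl hx), .refl⟩ (.base hx hxZ hxZ .refl))
  · by_cases hyZ : y ∈ Z
    · exact .inr hyZ
    · refine .inl ⟨⟨⟨y, .inl (.inr hy), .refl⟩, hyZ⟩, ?_⟩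
      rintro ⟨_, m, s, hs, hsy⟩
      exact not_dSeparated_of_topReach hasymm hs hsy hyZ hy hsep

variable [Nonempty V] [∀ X, Nontrivial (Val X)] [∀ X, Finite (Val X)]

theorem validates_of_dSeparated {G : V → V → Prop} (hG : WellFounded G) {X Y Z : Finset V}
    (hsep : DSeparated G (X : Set V) (Y : Set V) (Z : Set V)) :
    Validates.{u, v, w, w'} G (condIndepSchema Val X Y Z) := by
  classical
  rintro M - hmeas hMarkov rfl
  rw [holds_condIndepSchema]
  intro x y z
  have := hmeas.isProbabilityMeasure_jointDist
  let s₀ : Inst Val := fun W => if h : W ∈ Z then z ⟨W, h⟩ else Classical.arbitrary _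
  have hev : ∀ (S : Finset V) (y : ∀ W : S, Val W),
      MeasurableSet[sigmaOf Val (S : Set V)] {s : Inst Val | ∀ W : S, s W = y W} := by
    intro S y
    rw [show {s : Inst Val | ∀ W : S, s W = y W} = ⋂ W : S, {s : Inst Val | s W = y W} by
      ext s; simp]
    exact MeasurableSet.iInter fun W => measurableSet_sigmaOf_eval W.2 _
  have hz : agree (Z : Set V) s₀ = {s : Inst Val | ∀ W : Z, s W = z W} := by
    ext s
    refine ⟨fun h W => ?_, fun h W hW => ?_⟩
    · simpa [s₀] using h W W.2
    · simpa [s₀, Finset.mem_coe.1 hW] using h ⟨W, hW⟩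
  have hind := (indep_cond_iff _ (measurableSet_agree Z.finite_toSet s₀)).1
    (condIndepGiven_of_dSeparated hG hMarkov Z.finite_toSet hsep s₀) _ _ (hev X x) (hev Y y)
  have hreal : ∀ E : Set (Inst Val), MeasurableSet E →
      M.prob.real {e | M.solution e ∈ E} = M.jointDist.real E := fun E hE => by
    rw [SCM.jointDist, map_measureReal_apply hmeas.measurable_solution hE]
    rfl
  have hX := sigmaOf_le _ _ (hev X x)
  have hY := sigmaOf_le _ _ (hev Y y)
  have hZ := sigmaOf_le _ _ (hev Z z)
  rw [hz] at hind
  have h1 := hreal _ ((hX.inter hY).inter hZ)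
  have h2 := hreal _ hZ
  have h3 := hreal _ (hX.inter hZ)
  have h4 := hreal _ (hY.inter hZ)
  simp only [Set.mem_inter_iff, Set.mem_ofPred_eq] at h1 h2 h3 h4
  rw [h1, h2, h3, h4]
  have := congrArg ENNReal.toReal hind
  rw [ENNReal.toReal_mul, ENNReal.toReal_mul] at this
  simp only [measureReal_def]
  rw [Set.inter_comm _ {s : Inst Val | ∀ W : Z, s W = z W}, this,
    Set.inter_comm {s : Inst Val | ∀ W : Z, s W = z W},
    Set.inter_comm {s : Inst Val | ∀ W : Z, s W = z W}]

end Soundness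

/-! ### Models with a prescribed finitely supported distribution -/

section Prescribed

variable {V : Type u} {Val : V → Type v}

/-- The sets that do not separate `s` from `t` form a σ-algebra. -/
theorem mem_iff_of_agree {S : Set V} {a : Set (Inst Val)} (ha : MeasurableSet[sigmaOf Val S] a)
    {s t : Inst Val} (h : ∀ W ∈ S, s W = t W) : s ∈ a ↔ t ∈ a := by
  let m : MeasurableSpace (Inst Val) :=
    { MeasurableSet' := fun a => s ∈ a ↔ t ∈ a
      measurableSet_empty := by simp
      measurableSet_compl := fun a ha => not_congr ha
      measurableSet_iUnion := fun f hf => by simp only [Set.mem_iUnion, hf] }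
  have hm : sigmaOf Val S ≤ m := by
    refine iSup₂_le fun W hW => ?_
    rintro _ ⟨u, -, rfl⟩
    change s W ∈ u ↔ t W ∈ u
    rw [h W hW]
  exact hm a ha

/-- Given `N`, the conditional probability of `a` is a constant; the tower property carries the
product formula down to `P`. -/
theorem CondIndepVars.of_indep {μ : Measure (Inst Val)} [IsProbabilityMeasure μ] {A N P : Set V}
    (h : Indep (sigmaOf Val A) (sigmaOf Val N) μ) (hP : P ⊆ N) : CondIndepVars μ A N P := by
  intro a b ha hb
  have hN := sigmaOf_le (Val := Val) N
  have ha' : MeasurableSet a := sigmaOf_le A _ ha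
  have hb' : MeasurableSet b := hN _ hb
  have hone : ∀ t : Set (Inst Val), MeasurableSet t →
      Integrable (t.indicator fun _ => (1 : ℝ)) μ := fun t ht =>
    (integrable_const (1 : ℝ)).indicator ht
  have hprod : (b.indicator fun _ => (1 : ℝ)) * (a.indicator fun _ => (1 : ℝ)) =
      (a ∩ b).indicator fun _ => (1 : ℝ) := by
    ext s
    by_cases h1 : s ∈ a <;> by_cases h2 : s ∈ b <;> simp [h1, h2]
  have hsm : StronglyMeasurable[sigmaOf Val A] (a.indicator fun _ => (1 : ℝ)) :=
    stronglyMeasurable_const.indicator ha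
  have hsmb : StronglyMeasurable[sigmaOf Val N] (b.indicator fun _ => (1 : ℝ)) :=
    stronglyMeasurable_const.indicator hb
  set α := μ[a.indicator fun _ => (1 : ℝ)]
  have h1 : μ⟦a | sigmaOf Val N⟧ =ᵐ[μ] fun _ => α :=
    condExp_indep_eq (sigmaOf_le A) hN hsm h
  have h2 : μ⟦a | sigmaOf Val P⟧ =ᵐ[μ] fun _ => α :=
    condExp_indep_eq (sigmaOf_le A) (sigmaOf_le P) hsm
      (indep_of_indep_of_le_right h (sigmaOf_mono hP))
  have h3 : μ⟦a ∩ b | sigmaOf Val N⟧ =ᵐ[μ] α • b.indicator fun _ => (1 : ℝ) := by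
    rw [← hprod]
    refine (condExp_mul_of_stronglyMeasurable_left hsmb ?_ (hone a ha')).trans ?_
    · rw [hprod]
      exact hone _ (ha'.inter hb')
    · filter_upwards [h1] with s hs
      simp only [Pi.mul_apply, Pi.smul_apply, smul_eq_mul, hs, mul_comm]
  have h4 : μ⟦a ∩ b | sigmaOf Val P⟧ =ᵐ[μ] α • μ⟦b | sigmaOf Val P⟧ :=
    (condExp_condExp_of_le (sigmaOf_mono hP) hN).symm.trans
      ((condExp_congr_ae h3).trans (condExp_smul α _ _))
  filter_upwards [h2, h4] with s hs hs'
  rw [hs', Pi.mul_apply, hs, Pi.smul_apply, smul_eq_mul]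

/-- An event determined by `P` on the support agrees almost surely with an event about `P`, so its
conditional probability is an indicator and factors out. -/
theorem CondIndepVars.of_determined {Ω : Type*} [MeasurableSpace Ω] [DiscreteMeasurableSpace Ω]
    [Finite Ω] {ν : Measure Ω} [IsProbabilityMeasure ν] {σ : Ω → Inst Val} {A N P : Set V}
    (h : ∀ ω ω', (∀ W ∈ P, σ ω W = σ ω' W) → ∀ W ∈ A, σ ω W = σ ω' W) :
    CondIndepVars (ν.map σ) A N P := by
  intro a b ha hb
  have hσ : Measurable σ := Measurable.of_discrete
  have hμ : IsProbabilityMeasure (ν.map σ) := Measure.isProbabilityMeasure_map hσ.aemeasurable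
  set μ := ν.map σ
  have hP := sigmaOf_le (Val := Val) P
  have ha' : MeasurableSet a := sigmaOf_le A _ ha
  have hb' : MeasurableSet b := sigmaOf_le N _ hb
  have hsep : ∀ ω ω', ∃ E, MeasurableSet[sigmaOf Val P] E ∧ σ ω ∈ E ∧
      (σ ω ∈ a → σ ω' ∉ a → σ ω' ∉ E) := by
    intro ω ω'
    by_cases hc : σ ω ∈ a ∧ σ ω' ∉ a
    · have : ¬ ∀ W ∈ P, σ ω W = σ ω' W := fun hW =>
        hc.2 ((mem_iff_of_agree ha (h ω ω' hW)).1 hc.1)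
      push Not at this
      obtain ⟨W, hW, hne⟩ := this
      exact ⟨_, measurableSet_sigmaOf_eval hW (σ ω W), rfl, fun _ _ h => hne h.symm⟩
    · exact ⟨Set.univ, MeasurableSet.univ, trivial, fun h1 h2 => absurd ⟨h1, h2⟩ hc⟩
  choose E hE hE1 hE2 using hsep
  -- Finiteness of `Ω` keeps this event about `P` measurable even when `P` is infinite.
  let a' : Set (Inst Val) := ⋃ ω ∈ {ω | σ ω ∈ a}, ⋂ ω' ∈ {ω' | σ ω' ∉ a}, E ω ω'
  have haP : MeasurableSet[sigmaOf Val P] a' :=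
    MeasurableSet.biUnion (Set.to_countable _) fun ω _ =>
      MeasurableSet.biInter (Set.to_countable _) fun ω' _ => hE ω ω'
  have hmem : ∀ ω, σ ω ∈ a ↔ σ ω ∈ a' := by
    intro ω
    simp only [a', Set.mem_iUnion, Set.mem_iInter, Set.mem_ofPred_eq, exists_prop]
    constructor
    · exact fun hω => ⟨ω, hω, fun ω' _ => hE1 ω ω'⟩
    · rintro ⟨ω₀, h0, h1⟩
      by_contra hω
      exact hE2 ω₀ ω h0 hω (h1 ω hω)
  have hae : ∀ᵐ s ∂μ, s ∈ a ↔ s ∈ a' := by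
    have hm : MeasurableSet {s | s ∈ a ↔ s ∈ a'} := by
      rw [show {s | s ∈ a ↔ s ∈ a'} = a ∩ a' ∪ aᶜ ∩ a'ᶜ by ext s; simp; tauto]
      exact (ha'.inter (hP _ haP)).union (ha'.compl.inter (hP _ haP).compl)
    exact (ae_map_iff hσ.aemeasurable hm).2 (ae_of_all _ hmem)
  have hone : ∀ t : Set (Inst Val), MeasurableSet t →
      Integrable (t.indicator fun _ => (1 : ℝ)) μ := fun t ht =>
    (integrable_const (1 : ℝ)).indicator ht
  have hsm : StronglyMeasurable[sigmaOf Val P] (a'.indicator fun _ => (1 : ℝ)) :=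
    stronglyMeasurable_const.indicator haP
  have h1 : μ⟦a | sigmaOf Val P⟧ =ᵐ[μ] a'.indicator fun _ => (1 : ℝ) := by
    refine (condExp_congr_ae (g := a'.indicator fun _ => (1 : ℝ)) ?_).trans
      (condExp_of_stronglyMeasurable hP hsm (hone _ (hP _ haP))).eventuallyEq
    filter_upwards [hae] with s hs
    by_cases h : s ∈ a' <;> simp [hs, h]
  have hprod : (a'.indicator fun _ => (1 : ℝ)) * (b.indicator fun _ => (1 : ℝ)) =
      (a' ∩ b).indicator fun _ => (1 : ℝ) := by
    ext s
    by_cases h1 : s ∈ a' <;> by_cases h2 : s ∈ b <;> simp [h1, h2]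
  have h2 : μ⟦a ∩ b | sigmaOf Val P⟧ =ᵐ[μ]
      (a'.indicator fun _ => (1 : ℝ)) * μ⟦b | sigmaOf Val P⟧ := by
    refine (condExp_congr_ae (g := (a'.indicator fun _ => (1 : ℝ)) *
      (b.indicator fun _ => (1 : ℝ))) ?_).trans
      (condExp_mul_of_stronglyMeasurable_left hsm ?_ (hone _ hb'))
    · rw [hprod]
      filter_upwards [hae] with s hs
      by_cases h : s ∈ a' <;> by_cases h' : s ∈ b <;> simp [hs, h, h']
    · rw [hprod]
      exact hone _ ((hP _ haP).inter hb')
  exact h2.trans (h1.symm.mul .rfl)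

variable [∀ X, Nontrivial (Val X)] {Ω : Type} [MeasurableSpace Ω]

open Classical in
/-- The model with graph `G` whose solution at `ω` is `σ ω`: each variable takes the prescribed
value if its parents do and another value otherwise. -/
noncomputable def SCM.ofDist (G : V → V → Prop) (ν : Measure Ω) [IsProbabilityMeasure ν]
    [DiscreteMeasurableSpace Ω] (σ : Ω → Inst Val) : SCM.{u, v, w, w'} Val where
  Exo := PUnit.{w + 1}
  ExoVal := fun _ => ULift.{w'} Ω
  sigma := ⊤
  P := @Measure.map _ _ _ ⊤ (fun ω _ => ULift.up ω) ν
  isProb := @Measure.isProbabilityMeasure_map _ _ _ ⊤ ν _ _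
    (@Measurable.aemeasurable _ _ _ ⊤ _ ν (@Measurable.of_discrete _ _ _ ⊤ _ _))
  f := fun Y s e =>
    if ∀ X, G X Y → s X = σ (e PUnit.unit).down X then σ (e PUnit.unit).down Y
    else (exists_ne (σ (e PUnit.unit).down Y)).choose

variable [DiscreteMeasurableSpace Ω] {G : V → V → Prop} {ν : Measure Ω} [IsProbabilityMeasure ν]
  {σ : Ω → Inst Val}

theorem SCM.ofDist_f_of_agree {Y : V} {s : Inst Val}
    {e : (SCM.ofDist.{u, v, w, w'} G ν σ).ExoInst}
    (h : ∀ X, G X Y → s X = σ (e PUnit.unit).down X) :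
    (SCM.ofDist G ν σ).f Y s e = σ (e PUnit.unit).down Y :=
  if_pos h

theorem SCM.ofDist_f_of_not_agree {Y : V} {s : Inst Val}
    {e : (SCM.ofDist.{u, v, w, w'} G ν σ).ExoInst}
    (h : ¬ ∀ X, G X Y → s X = σ (e PUnit.unit).down X) :
    (SCM.ofDist G ν σ).f Y s e ≠ σ (e PUnit.unit).down Y := by
  rw [show (SCM.ofDist G ν σ).f Y s e = (exists_ne (σ (e PUnit.unit).down Y)).choose from if_neg h]
  exact (exists_ne (σ (e PUnit.unit).down Y)).choose_spec

theorem SCM.ofDist_f_congr {Y : V} {s t : Inst Val}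
    {e : (SCM.ofDist.{u, v, w, w'} G ν σ).ExoInst}
    (h : ∀ X, G X Y → s X = t X) :
    (SCM.ofDist G ν σ).f Y s e = (SCM.ofDist G ν σ).f Y t e := by
  have hiff : (∀ X, G X Y → s X = σ (e PUnit.unit).down X) ↔
      ∀ X, G X Y → t X = σ (e PUnit.unit).down X :=
    forall₂_congr fun X hX => by rw [h X hX]
  by_cases hs : ∀ X, G X Y → s X = σ (e PUnit.unit).down X
  · exact (SCM.ofDist_f_of_agree hs).trans (SCM.ofDist_f_of_agree (hiff.1 hs)).symm
  · exact (if_neg hs : _ = (exists_ne (σ (e PUnit.unit).down Y)).choose).trans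
      (if_neg (mt hiff.2 hs) : _ = (exists_ne (σ (e PUnit.unit).down Y)).choose).symm

theorem SCM.isRecursive_ofDist (hG : WellFounded G) :
    (SCM.ofDist.{u, v, w, w'} G ν σ).IsRecursive := by
  have : IsWellFounded V G := ⟨hG⟩
  obtain ⟨r, hr, hwo⟩ := IsWellFounded.exists_well_order_ge G
  exact ⟨r, hwo, fun X e s t h => SCM.ofDist_f_congr fun Y hY => h Y (hr _ _ hY)⟩

theorem SCM.isMeasurable_ofDist : (SCM.ofDist.{u, v, w, w'} G ν σ).IsMeasurable :=
  fun _ _ => measurable_from_top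

theorem SCM.solution_ofDist (hG : WellFounded G)
    (e : (SCM.ofDist.{u, v, w, w'} G ν σ).ExoInst) :
    (SCM.ofDist G ν σ).solution e = σ (e PUnit.unit).down := by
  have hrec := SCM.isRecursive_ofDist.{u, v, w, w'} (ν := ν) (σ := σ) hG
  exact (hrec.existsUnique_isSolution e).unique (hrec.solution_spec e)
    fun X => (SCM.ofDist_f_of_agree fun _ _ => rfl).symm

theorem SCM.prob_ofDist (E : Set Ω) :
    (SCM.ofDist.{u, v, w, w'} G ν σ).prob {e | (e PUnit.unit).down ∈ E} = ν E :=
  @Measure.map_apply _ _ _ ⊤ ν _ (@Measurable.of_discrete _ _ _ ⊤ _ _) _ trivial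

theorem SCM.jointDist_ofDist (hG : WellFounded G) :
    (SCM.ofDist.{u, v, w, w'} G ν σ).jointDist = ν.map σ := by
  ext E hE
  rw [SCM.jointDist, Measure.map_apply SCM.isMeasurable_ofDist.measurable_solution hE,
    Measure.map_apply Measurable.of_discrete hE, ← SCM.prob_ofDist (G := G) (σ := σ)]
  congr 1
  ext e
  change (SCM.ofDist G ν σ).solution e ∈ E ↔ _
  rw [SCM.solution_ofDist hG]
  rfl

/-- At an `ω` of positive mass, changing one parent in `σ ω` breaks the agreement and moves `Y` off
its prescribed value, so every edge of `G` is a real influence, whatever the distribution. -/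
theorem SCM.influences_ofDist (hν : ∃ ω, ν {ω} ≠ 0) :
    (SCM.ofDist.{u, v, w, w'} G ν σ).Influences = G := by
  classical
  ext X Y
  constructor
  · rintro ⟨s, t, A, -, hst, hA, h⟩
    by_contra hXY
    obtain ⟨e, he⟩ := nonempty_of_measure_ne_zero hA
    refine (h e he e he).2.1 (SCM.ofDist_f_congr fun W hW => hst W ?_)
    rintro rfl
    exact hXY hW
  · intro hXY
    obtain ⟨ω, hω⟩ := hν
    obtain ⟨x, hx⟩ := exists_ne (σ ω X)
    have key : ∀ e : (SCM.ofDist.{u, v, w, w'} G ν σ).ExoInst, (e PUnit.unit).down = ω →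
        (SCM.ofDist G ν σ).f Y (σ ω) e = σ ω Y ∧
        (SCM.ofDist G ν σ).f Y (Function.update (σ ω) X x) e ≠ σ ω Y := by
      rintro e rfl
      refine ⟨SCM.ofDist_f_of_agree fun _ _ => rfl, SCM.ofDist_f_of_not_agree fun h => hx ?_⟩
      exact (Function.update_self X x (σ (e PUnit.unit).down)).symm.trans (h X hXY)
    refine ⟨σ ω, Function.update (σ ω) X x, {e | (e PUnit.unit).down ∈ ({ω} : Set Ω)},
      fun h => hx (h.trans (Function.update_self X x (σ ω))).symm, fun W hW => (Function.update_of_ne hW _ _).symm,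
      by rwa [SCM.prob_ofDist], fun e he e' he' => ?_⟩
    have hee : e = e' := by
      funext i
      exact ULift.down_injective (he.trans he'.symm)
    subst hee
    exact ⟨rfl, fun h => (key e he).2 (h.symm.trans (key e he).1), rfl⟩

end Prescribed

/-! ### Parities of fair coins -/

section Parity

variable {ι : Type} {V : Type u} {Val : V → Type v} [∀ X, Nontrivial (Val X)]

/-- The instantiation in which each variable `v` shows the parity of the coins in `S v`. -/
noncomputable def parityInst (Val : V → Type v) [∀ X, Nontrivial (Val X)] (S : V → Finset ι)
    (ω : ι → ZMod 2) : Inst Val := fun v =>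
  if ∑ i ∈ S v, ω i = 0 then (exists_pair_ne (Val v)).choose
  else (exists_pair_ne (Val v)).choose_spec.choose

theorem parityInst_eq_iff {S : V → Finset ι} {ω ω' : ι → ZMod 2} {v : V} :
    parityInst Val S ω v = parityInst Val S ω' v ↔ ∑ i ∈ S v, ω i = ∑ i ∈ S v, ω' i := by
  have hne := (exists_pair_ne (Val v)).choose_spec.choose_spec
  have hz : ∀ x y : ZMod 2, ¬ x = 0 → ¬ y = 0 → x = y := by decide
  unfold parityInst
  split_ifs with h1 h2 h2
  · simp [h1, h2]
  · simp only [hne, h1, false_iff]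
    exact fun h => h2 h.symm
  · simp only [hne.symm, h2, h1]
  · simp only [true_iff]
    exact hz _ _ h1 h2

/-- A nonempty proper subset of `S` is a singleton and reveals its coin. So either the whole sum is
given or every coin is. -/
theorem sum_eq_of_card_le_two {S : Finset ι} (hS : S.card ≤ 2) {ω ω' : ι → ZMod 2}
    (h : ∀ i ∈ S, ∃ T ⊆ S, i ∈ T ∧ ∑ j ∈ T, ω j = ∑ j ∈ T, ω' j) :
    ∑ j ∈ S, ω j = ∑ j ∈ S, ω' j := by
  by_cases hex : ∃ i ∈ S, ω i ≠ ω' i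
  · obtain ⟨i, hi, hne⟩ := hex
    obtain ⟨T, hTS, hiT, hT⟩ := h i hi
    rcases hTS.eq_or_ssubset with rfl | hss
    · exact hT
    · have hcard : T.card ≤ 1 := by
        have := Finset.card_lt_card hss
        omega
      have : T = {i} := Finset.eq_singleton_iff_unique_mem.2
        ⟨hiT, fun j hj => Finset.card_le_one.1 hcard j hj i hiT⟩
      rw [this] at hT
      simp [hne] at hT
  · push Not at hex
    exact Finset.sum_congr rfl hex

end Parity

/-! ### Independent fair coins and the local Markov property of their parities -/

section Coins

variable {ι : Type} [Fintype ι]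

/-- The distribution of independent fair coins indexed by `ι`. -/
noncomputable def coinMeasure (ι : Type) [Fintype ι] : Measure (ι → ZMod 2) := uniformOn Set.univ

instance : IsProbabilityMeasure (coinMeasure ι) :=
  isProbabilityMeasure_uniformOn Set.finite_univ Set.univ_nonempty

variable [DecidableEq ι]

theorem coinMeasure_apply (E : Set (ι → ZMod 2)) :
    coinMeasure ι E = Measure.count E / Fintype.card (ι → ZMod 2) := by
  exact uniformOn_univ

theorem coinMeasure_singleton (ω : ι → ZMod 2) :
    coinMeasure ι {ω} = (Fintype.card (ι → ZMod 2) : ENNReal)⁻¹ := by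
  rw [coinMeasure_apply, Measure.count_singleton, one_div]

theorem coinMeasure_singleton_ne_zero (ω : ι → ZMod 2) : coinMeasure ι {ω} ≠ 0 := by
  rw [coinMeasure_singleton]
  exact ENNReal.inv_ne_zero.2 (ENNReal.natCast_ne_top _)

theorem coinMeasure_flip (i : ι) (E : Set (ι → ZMod 2)) :
    coinMeasure ι ((fun ω : ι → ZMod 2 => ω + Pi.single i 1) ⁻¹' E) = coinMeasure ι E := by
  rw [coinMeasure_apply, coinMeasure_apply, Measure.count_apply (.of_discrete),
    Measure.count_apply (.of_discrete), Set.encard_preimage_of_bijective]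
  exact (Equiv.addRight (Pi.single i 1 : ι → ZMod 2)).bijective

/-- Events about the coin `i` are independent of events that do not depend on it. -/
theorem coinMeasure_inter {i : ι} {a b : Set (ι → ZMod 2)}
    (ha : ∀ ω ω', ω i = ω' i → (ω ∈ a ↔ ω' ∈ a)) (hb : ∀ ω, ω + Pi.single i 1 ∈ b ↔ ω ∈ b) :
    coinMeasure ι (a ∩ b) = coinMeasure ι a * coinMeasure ι b := by
  set ν := coinMeasure ι with hν
  let c : Set (ι → ZMod 2) := {ω | ω i = 0}
  have hz : ∀ x : ZMod 2, x + 1 = 0 ↔ ¬ x = 0 := by decide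
  -- Flipping coin `i` exchanges the two halves of `b` and preserves the measure.
  have hflip : ∀ b : Set (ι → ZMod 2), (∀ ω, ω + Pi.single i 1 ∈ b ↔ ω ∈ b) →
      ν.real (c ∩ b) = ν.real b / 2 ∧ ν.real (cᶜ ∩ b) = ν.real b / 2 := by
    intro b hb
    have h1 : ν.real (cᶜ ∩ b) = ν.real (c ∩ b) := by
      rw [measureReal_def, measureReal_def, hν, ← coinMeasure_flip i (c ∩ b)]
      congr 2
      ext ω
      simp only [c, Set.mem_inter_iff, Set.mem_compl_iff, Set.mem_ofPred_eq, Set.mem_preimage, hb,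
        Pi.add_apply, Pi.single_eq_same, hz]
    have h2 : ν.real (b ∩ c) + ν.real (b \ c) = ν.real b :=
      measureReal_inter_add_sdiff .of_discrete
    rw [Set.inter_comm, Set.sdiff_eq, Set.inter_comm b cᶜ] at h2
    constructor <;> linarith
  have hc := hflip b hb
  have hu := hflip Set.univ (fun ω => by simp)
  simp only [Set.inter_univ, probReal_univ] at hu
  have main : ν.real (a ∩ b) = ν.real a * ν.real b := by
    have hz' : ∀ x : ZMod 2, ¬ x = 0 ↔ x = 1 := by decide
    -- Being about coin `i` alone, `a` is one of `∅`, `c`, `cᶜ` and the whole space.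
    have hmem : ∀ ω, ω ∈ a ↔ (ω i = 0 ∧ 0 ∈ a) ∨ (¬ ω i = 0 ∧ Pi.single i 1 ∈ a) := by
      intro ω
      by_cases h : ω i = 0
      · simp [h, ha ω 0 (by simpa using h)]
      · simp [h, ha ω (Pi.single i 1) (by simpa using (hz' _).1 h)]
    by_cases h0 : (0 : ι → ZMod 2) ∈ a <;> by_cases h1 : (Pi.single i 1 : ι → ZMod 2) ∈ a
    · have : a = Set.univ := by ext ω; rw [hmem]; simp [h0, h1, em]
      simp [this]
    · have : a = c := by ext ω; rw [hmem]; simp [h0, h1, c]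
      rw [this, hc.1, hu.1]; ring
    · have : a = cᶜ := by ext ω; rw [hmem]; simp [h0, h1, c]
      rw [this, hc.2, hu.2]; ring
    · have : a = ∅ := by ext ω; rw [hmem]; simp [h0, h1]
      simp [this]
  rw [measureReal_def, measureReal_def, measureReal_def, ← ENNReal.toReal_mul,
    ENNReal.toReal_eq_toReal_iff' (measure_ne_top _ _)
      (ENNReal.mul_ne_top (measure_ne_top _ _) (measure_ne_top _ _))] at main
  exact main

/-- If each coin is tossed at a vertex all of whose descendants, but no other vertices, may depend
on it, and all other vertices depend on the coins through their parents, then the parities have the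
local Markov property. -/
theorem condIndepVars_parity {V : Type u} {Val : V → Type v} [∀ X, Nontrivial (Val X)]
    {G : V → V → Prop} (hG : ∀ a b, G a b → ¬ Relation.ReflTransGen G b a)
    {S : V → Finset ι} {top : ι → V} (htop : ∀ i, S (top i) = {i})
    (hdesc : ∀ v, ∀ i ∈ S v, Relation.ReflTransGen G (top i) v)
    (hpar : ∀ v, ∀ i ∈ S v, v ≠ top i → ∃ w, G w v ∧ i ∈ S w ∧ S w ⊆ S v)
    (hcard : ∀ v, (S v).card ≤ 2) (v : V) :
    CondIndepVars ((coinMeasure ι).map (parityInst Val S)) {v}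
      {y | ¬ Relation.ReflTransGen G v y} {y | G y v} := by
  have hσ : Measurable (parityInst Val S) := Measurable.of_discrete
  have := Measure.isProbabilityMeasure_map (μ := coinMeasure ι) hσ.aemeasurable
  -- A top shows its own coin, which no non-descendant depends on; any other vertex is determined by
  -- its parents.
  by_cases hv : ∃ i, v = top i
  · obtain ⟨i, rfl⟩ := hv
    refine CondIndepVars.of_indep ?_ fun w hw => hG _ _ hw
    rw [Indep_iff]
    intro a b ha hb
    have ha' := sigmaOf_le _ _ ha
    have hb' := sigmaOf_le _ _ hb
    rw [Measure.map_apply hσ (ha'.inter hb'), Measure.map_apply hσ ha', Measure.map_apply hσ hb']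
    refine coinMeasure_inter (i := i) (fun ω ω' h => mem_iff_of_agree ha ?_)
      fun ω => mem_iff_of_agree hb ?_
    · rintro _ rfl
      simpa [parityInst_eq_iff, htop] using h
    · intro w hw
      rw [parityInst_eq_iff]
      refine Finset.sum_congr rfl fun j hj => ?_
      have : j ≠ i := by
        rintro rfl
        exact hw (hdesc w j hj)
      simp [this]
  · push Not at hv
    refine CondIndepVars.of_determined fun ω ω' h => ?_
    rintro _ rfl
    rw [parityInst_eq_iff]
    refine sum_eq_of_card_le_two (hcard _) fun i hi => ?_
    obtain ⟨w, hw, hiw, hwv⟩ := hpar _ i hi (hv i)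
    exact ⟨S w, hwv, hiw, parityInst_eq_iff.1 (h w hw)⟩

end Coins

/-! ### Completeness -/

section Completeness

variable {V : Type u} {Val : V → Type v} [Nonempty V] [∀ X, Nontrivial (Val X)]
  [∀ X, Finite (Val X)]

/-- A distribution of parities of coins violates the schema if every variable in `Z` shows an even
number of coins, two patterns only agree with the constant pattern `1` on `Z`, and both `X` and `Y`
distinguish these patterns. -/
theorem not_holds_of_parity {G : V → V → Prop} (hG : WellFounded G) {ι : Type} [Fintype ι]
    [DecidableEq ι] [Nonempty ι] {S : V → Finset ι} {X Y Z : Finset V} {a b : V} {i j : ι}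
    (ha : a ∈ X) (hb : b ∈ Y) (hSa : S a = {i}) (hSb : S b = {j})
    (hZ : ∀ ω : ι → ZMod 2, (∀ z ∈ Z, ∑ l ∈ S z, ω l = ∑ _l ∈ S z, 1) ↔ ω = 0 ∨ ω = 1) :
    ¬ (condIndepSchema Val X Y Z).Holds
      (SCM.ofDist.{u, v, w, w'} G (coinMeasure ι) (parityInst Val S)) := by
  intro h
  rw [holds_condIndepSchema] at h
  replace h := h (fun W => parityInst Val S 1 W) (fun W => parityInst Val S 1 W)
    (fun W => parityInst Val S 1 W)
  have hpr : ∀ p : Inst Val → Prop,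
      (SCM.ofDist.{u, v, w, w'} G (coinMeasure ι) (parityInst Val S)).prob.real
        {e | p ((SCM.ofDist.{u, v, w, w'} G (coinMeasure ι) (parityInst Val S)).solution e)} =
      (coinMeasure ι).real {ω | p (parityInst Val S ω)} := by
    intro p
    rw [measureReal_def, measureReal_def, ← SCM.prob_ofDist (G := G) (σ := parityInst Val S)]
    simp only [SCM.solution_ofDist hG]
    rfl
  rw [hpr fun s => ((∀ W : X, s W = parityInst Val S 1 W) ∧
      ∀ W : Y, s W = parityInst Val S 1 W) ∧ ∀ W : Z, s W = parityInst Val S 1 W,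
    hpr fun s => ∀ W : Z, s W = parityInst Val S 1 W,
    hpr fun s => (∀ W : X, s W = parityInst Val S 1 W) ∧ ∀ W : Z, s W = parityInst Val S 1 W,
    hpr fun s => (∀ W : Y, s W = parityInst Val S 1 W) ∧ ∀ W : Z, s W = parityInst Val S 1 W] at h
  have hZ' : ∀ ω, (∀ W : Z, parityInst Val S ω W = parityInst Val S 1 W) ↔ ω = 0 ∨ ω = 1 := by
    intro ω
    rw [← hZ]
    simp [parityInst_eq_iff]
  have hzero : ∀ {c : V} {l : ι}, S c = {l} →
      ¬ parityInst Val S (0 : ι → ZMod 2) c = parityInst Val S 1 c := by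
    intro c l hc
    simp [parityInst_eq_iff, hc]
  have hX0 : ¬ ∀ W : X, parityInst Val S (0 : ι → ZMod 2) W = parityInst Val S 1 W :=
    fun h => hzero hSa (h ⟨a, ha⟩)
  have hY0 : ¬ ∀ W : Y, parityInst Val S (0 : ι → ZMod 2) W = parityInst Val S 1 W :=
    fun h => hzero hSb (h ⟨b, hb⟩)
  have hone : ∀ q : (ι → ZMod 2) → Prop, q 1 → ¬ q 0 →
      {ω : ι → ZMod 2 | q ω ∧ (ω = 0 ∨ ω = 1)} = {1} := by
    intro q h1 h0
    ext ω
    simp only [Set.mem_ofPred_eq, Set.mem_singleton_iff]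
    constructor
    · rintro ⟨hq, rfl | rfl⟩
      exacts [absurd hq h0, rfl]
    · rintro rfl
      exact ⟨h1, .inr rfl⟩
  simp only [hZ'] at h
  -- With `p` the mass of one pattern, the condition on `Z` has mass `2p` and the other three events
  -- mass `p`, so the instance reads `p · 2p = p · p`.
  rw [hone _ ⟨fun _ => rfl, fun _ => rfl⟩ fun h => hX0 h.1, hone _ (fun _ => rfl) hX0,
    hone _ (fun _ => rfl) hY0,
    show {ω : ι → ZMod 2 | ω = 0 ∨ ω = 1} = {0} ∪ {1} from rfl,
    measureReal_union (by simp) (.of_discrete)] at h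
  have heq : (coinMeasure ι).real {0} = (coinMeasure ι).real {1} := by
    simp only [measureReal_def, coinMeasure_singleton]
  have hpos : 0 < (coinMeasure ι).real {(1 : ι → ZMod 2)} :=
    ENNReal.toReal_pos (coinMeasure_singleton_ne_zero _) (measure_ne_top _ _)
  rw [heq] at h
  nlinarith

theorem dSeparated_of_validates {G : V → V → Prop} (hG : WellFounded G) {X Y Z : Finset V}
    (h : Validates.{u, v, w, w'} G (condIndepSchema Val X Y Z)) :
    DSeparated G (X : Set V) (Y : Set V) (Z : Set V) := by
  classical
  intro n p h0 hn hp
  have hasymm : ∀ a b, G a b → ¬ G b a := fun a b h h' => hG.asymmetric _ _ h h'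
  have hacyc : ∀ a b, G a b → ¬ Relation.ReflTransGen G b a := fun a b h h' =>
    hG.transGen.irrefl.irrefl _ (Relation.TransGen.head' h h')
  obtain ⟨k, s, z, hz, h0a, hkb, ha, hb, hst⟩ :=
    exists_minimal_chain (hp.exists_topReach hasymm (X := {p 0}) rfl)
  have haZ := hp.start_notMem
  have hbZ := hp.end_notMem
  generalize p 0 = a at *
  generalize p n = b at *
  -- Coins are shown only at vertices that still lead to `a`, `b` or a chosen `z m`. Elsewhere, in
  -- particular at the other members of `Z`, the parity is empty and the value constant.
  let T : V → Prop := fun v => Avoids G Z v a ∨ Avoids G Z v b ∨ ∃ m < k, Avoids G Z v (z m)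
  let S : V → Finset (Fin (k + 1)) := fun v => {i | T v ∧ Avoids G Z (s i) v}
  have hS : ∀ {v i}, i ∈ S v ↔ T v ∧ Avoids G Z (s i) v := by simp [S]
  have hTpar : ∀ {w v}, G w v → w ∉ (Z : Set V) → T v → T w := by
    rintro w v hwv hw (h | h | ⟨m, hm, h⟩)
    · exact .inl (.head ⟨hwv, hw⟩ h)
    · exact .inr (.inl (.head ⟨hwv, hw⟩ h))
    · exact .inr (.inr ⟨m, hm, .head ⟨hwv, hw⟩ h⟩)
  have hzI : ∀ m < k, ∀ i ≤ k, Avoids G Z (s i) (z m) → i = m ∨ i = m + 1 := by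
    intro m hm i hi h
    have h1 := hst m hm.le i hi _ (hz m hm).1 (hz m hm).2.1 h
    have h2 := hst i hi (m + 1) hm _ (hz m hm).1 h (hz m hm).2.2
    omega
  have hloc : ∀ v, T v → ∃ m, ∀ i ≤ k, Avoids G Z (s i) v → i = m ∨ i = m + 1 := by
    rintro v (h | h | ⟨m, hm, h⟩)
    · exact ⟨0, fun i hi hiv => .inl (ha i hi (hiv.trans h))⟩
    · exact ⟨k, fun i hi hiv => .inl (hb i hi (hiv.trans h))⟩
    · exact ⟨m, fun i hi hiv => hzI m hm i hi (hiv.trans h)⟩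
  have hle : ∀ i : Fin (k + 1), (i : ℕ) ≤ k := fun i => Nat.lt_succ_iff.1 i.2
  -- The top `s i` leads to `z (i - 1)` (or `a`) and to `z i` (or `b`), and only coin `i` can reach
  -- both.
  have hself : ∀ i ≤ k, ∀ j ≤ k, Avoids G Z (s j) (s i) → j = i := by
    intro i hi j hj h
    have hlo : j = i ∨ j + 1 = i := by
      cases i with
      | zero => exact .inl (ha j hj (h.trans h0a))
      | succ i =>
        have := hzI i hi j hj (h.trans (hz i hi).2.2)
        omega
    have hhi : j = i ∨ j = i + 1 := by
      rcases hi.eq_or_lt with rfl | hlt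
      · exact .inl (hb j hj (h.trans hkb))
      · exact hzI i hlt j hj (h.trans (hz i hlt).2.1)
    omega
  have hTs : ∀ i ≤ k, T (s i) := by
    intro i hi
    rcases hi.eq_or_lt with rfl | hlt
    exacts [.inr (.inl hkb), .inr (.inr ⟨i, hlt, (hz i hlt).2.1⟩)]
  have htop : ∀ i : Fin (k + 1), S (s i) = {i} := by
    intro i
    ext j
    rw [hS, Finset.mem_singleton]
    refine ⟨fun h => Fin.ext (hself i (hle i) j (hle j) h.2), ?_⟩
    rintro rfl
    exact ⟨hTs _ (hle j), .refl⟩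
  have hcard : ∀ v, (S v).card ≤ 2 := by
    intro v
    by_cases hv : T v
    · obtain ⟨m, hm⟩ := hloc v hv
      refine (Finset.card_le_card_of_injOn (t := {m, m + 1}) (fun i : Fin (k + 1) => (i : ℕ)) ?_
        Fin.val_injective.injOn).trans Finset.card_le_two
      intro i hi
      simpa using hm i (hle i) (hS.1 hi).2
    · have : S v = ∅ := Finset.eq_empty_of_forall_notMem fun i hi => hv (hS.1 hi).1
      simp [this]
  have hpar : ∀ v, ∀ i ∈ S v, v ≠ s i → ∃ w, G w v ∧ i ∈ S w ∧ S w ⊆ S v := by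
    intro v i hi hne
    obtain ⟨hv, hiv⟩ := hS.1 hi
    rcases Relation.ReflTransGen.cases_tail hiv with rfl | ⟨w, hiw, hwv, hw⟩
    · exact absurd rfl hne
    · exact ⟨w, hwv, hS.2 ⟨hTpar hwv hw hv, hiw⟩,
        fun j hj => hS.2 ⟨hv, (hS.1 hj).2.tail ⟨hwv, hw⟩⟩⟩
  have hSa : S a = {⟨0, by omega⟩} := by
    ext i
    rw [hS, Finset.mem_singleton]
    refine ⟨fun h => Fin.ext (ha i (hle i) h.2), ?_⟩
    rintro rfl
    exact ⟨.inl .refl, h0a⟩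
  have hSb : S b = {⟨k, by omega⟩} := by
    ext i
    rw [hS, Finset.mem_singleton]
    refine ⟨fun h => Fin.ext (hb i (hle i) h.2), ?_⟩
    rintro rfl
    exact ⟨.inr (.inl .refl), hkb⟩
  have hSz : ∀ m (hm : m < k), S (z m) = {⟨m, by omega⟩, ⟨m + 1, by omega⟩} := by
    intro m hm
    ext i
    rw [hS, Finset.mem_insert, Finset.mem_singleton, Fin.ext_iff, Fin.ext_iff]
    refine ⟨fun h => hzI m hm i (hle i) h.2, fun h => ⟨.inr (.inr ⟨m, hm, .refl⟩), ?_⟩⟩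
    rcases h with h | h
    · rw [h]; exact (hz m hm).2.1
    · rw [h]; exact (hz m hm).2.2
  have hsum : ∀ m (hm : m < k) (ω : Fin (k + 1) → ZMod 2),
      ∑ i ∈ S (z m), ω i = ω ⟨m, by omega⟩ + ω ⟨m + 1, by omega⟩ := by
    intro m hm ω
    rw [hSz m hm, Finset.sum_pair (by simp)]
  have hadd : ∀ x y : ZMod 2, x + y = 1 + 1 ↔ x = y := by decide
  have hcoin : ∀ x : ZMod 2, x = 0 ∨ x = 1 := by decide
  refine not_holds_of_parity hG (S := S) h0 hn hSa hSb (fun ω => ?_) (h _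
    (SCM.isRecursive_ofDist hG) SCM.isMeasurable_ofDist ?_
    (SCM.influences_ofDist ⟨0, coinMeasure_singleton_ne_zero _⟩))
  · constructor
    · intro hω
      -- Even parity at `z m` makes coins `m` and `m + 1` equal.
      have hconst : ∀ m (hm : m < k + 1), ω ⟨m, hm⟩ = ω ⟨0, by omega⟩ := by
        intro m
        induction m with
        | zero => exact fun _ => rfl
        | succ m ih =>
          intro hm
          rw [← ih (by omega)]
          have := hω (z m) (hz m (by omega)).1
          rw [hsum m (by omega), hsum m (by omega) fun _ => 1] at this
          exact ((hadd _ _).1 this).symm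
      refine (hcoin (ω ⟨0, by omega⟩)).imp (fun h => ?_) fun h => ?_ <;>
      · funext i
        exact (hconst i i.2).trans h
    · rintro (rfl | rfl) y hy
      · by_cases hT : T y
        · obtain ⟨m, hm, rfl⟩ : ∃ m, ∃ _ : m < k, y = z m := by
            rcases hT with h | h | ⟨m, hm, h⟩
            · exact absurd (h.eq_of_mem hy ▸ hy) haZ
            · exact absurd (h.eq_of_mem hy ▸ hy) hbZ
            · exact ⟨m, hm, h.eq_of_mem hy⟩
          rw [hsum m hm, hsum m hm fun _ => 1]
          rfl
        · have : S y = ∅ := Finset.eq_empty_of_forall_notMem fun i hi => hT (hS.1 hi).1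
          simp [this]
      · rfl
  · intro v
    rw [SCM.jointDist_ofDist hG,
      SCM.influences_ofDist ⟨0, coinMeasure_singleton_ne_zero _⟩]
    exact condIndepVars_parity hacyc htop (fun v i hi => (hS.1 hi).2.reach) hpar hcard v

end Completeness

end CausalLogic

theorem mainTheorem7 {V : Type u} [Nonempty V] (Val : V → Type v) [∀ X, Finite (Val X)]
    [∀ X, Nontrivial (Val X)] :
    (∀ G : V → V → Prop, WellFounded G → ∀ X Y Z : Finset V,
      (CausalLogic.Validates.{u, v, w, w'} G (CausalLogic.condIndepSchema Val X Y Z) ↔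
        CausalLogic.DSeparated G (X : Set V) (Y : Set V) (Z : Set V))) ∧
    (∀ X Y Z : Finset V, ∃ φ : CausalLogic.L1 Val, ∀ G : V → V → Prop, WellFounded G →
      (CausalLogic.Validates.{u, v, w, w'} G φ ↔
        CausalLogic.DSeparated G (X : Set V) (Y : Set V) (Z : Set V))) := by
  have key : ∀ G : V → V → Prop, WellFounded G → ∀ X Y Z : Finset V,
      (CausalLogic.Validates.{u, v, w, w'} G (CausalLogic.condIndepSchema Val X Y Z) ↔
        CausalLogic.DSeparated G (X : Set V) (Y : Set V) (Z : Set V)) := fun _ hG _ _ _ =>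
    ⟨CausalLogic.dSeparated_of_validates hG, CausalLogic.validates_of_dSeparated hG⟩
  exact ⟨key, fun X Y Z => ⟨CausalLogic.condIndepSchema Val X Y Z, fun G hG => key G hG X Y Z⟩⟩
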